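/- **Theorem 2.** Let $m\ge 1$, $L=\{1,\dots,m\}$, and let $\mathbf X$ and $\mathbf Y$ be $m$-dimensional real random vectors with distribution functions $F_{\mathbf X}(\mathbf z)=\mathbb P(X_1\le z_1,\dots,X_m\le z_m)$ and $F_{\mathbf Y}$, and characteristic functions $\varphi_{\mathbf X}(\mathbf t)=\mathbb E(e^{i\langle \mathbf t,\mathbf X\rangle})$ and $\varphi_{\mathbf Y}$. Assume that $F_{\mathbf Y}$ is differentiable on $\mathbb R^m$. For $J\subseteq L$ let $\psi_J\colon\mathbb R^m\to\mathbb R^m$ be the projection that keeps the coordinates with index in $J$ and replaces all others by $0$. For a function $h\colon\mathbb R^m\to\mathbb C$ put $$\Lambda(h)(\mathbf t)=\sum_{\alpha}(-1)^{|\alpha|-1}(|\alpha|-1)!\prod_{J\in\alpha}h(\psi_J(\mathbf t)),$$ where the sum runs over all set partitions $\alpha$ of $L$ and $|\alpha|$ is the number of parts of $\alpha$. For nonempty $J\subseteq L$ let $\mathbf X_J=(X_j)_{j\in J}$, $\mathbf Y_J=(Y_j)_{j\in J}$, and for $1\le j\le m$ let $$A_j=\sup_{\mathbf y\in\mathbb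 R^m}\frac{\partial F_{\mathbf Y}}{\partial y_j}(\mathbf y)\in[0,\infty],\qquad B_j=\sum_{k=1}^{j}{j\brace k}k!,$$ $$C_1=\sqrt[3]{\frac{32}{\pi\bigl(1-(3/4)^{1/m}\bigr)}},\qquad C_2=\frac{12}{\pi},$$ where ${j\brace k}$ is the Stirling number of the second kind. Let $T>0$ and let $\|\mathbf t\|=\max_\ell|t_\ell|$. Then $$\begin{aligned}\sup_{\mathbf z\in\mathbb R^m}|F_{\mathbf X}(\mathbf z)-F_{\mathbf Y}(\mathbf z)|\le{}&\frac{2}{(2\pi)^m}\int_{\|\mathbf t\|\le T}\left|\frac{\Lambda(\varphi_{\mathbf X})(\mathbf t)-\Lambda(\varphi_{\mathbf Y})(\mathbf t)}{\prod_{\ell=1}^m t_\ell}\right|d\mathbf t\\&+2\sum_{\emptyset\ne J\subsetneq L}B_{m-|J|}\sup_{\mathbf z\in\mathbb R^J}|F_{\mathbf X_J}(\mathbf z)-F_{\mathbf Y_J}(\mathbf z)|+\frac{2\sum_{j=1}^mA_j}{T}(C_1+C_2),\end{aligned}$$ where the right-hand side may be $+\infty$. If the expectations $\mathbb E(\mathbf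 X)$ and $\mathbb E(\mathbf Y)$ exist (that is, all components of $\mathbf X$ and $\mathbf Y$ are integrable), then the integral on the right-hand side is finite. -/

import Mathlib

open MeasureTheory
open scoped ENNReal

noncomputable section

namespace BerryEsseen

/-- The coefficient `(-1) ^ (|α| - 1) * (|α| - 1)!` of a set partition `α` of a finite index
set `κ`. A partition of a nonempty set has at least one part, so the subtraction is exact. -/
def partitionCoeff {κ : Type*} [Fintype κ] [DecidableEq κ]
    (α : Finpartition (Finset.univ : Finset κ)) : ℂ :=
  (-1) ^ (α.parts.card - 1) * ((α.parts.card - 1).factorial : ℂ)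

/-- The coordinate projection that keeps the coordinates in `J` and sets all others to `0`. -/
def zeroOutside {κ R : Type*} [DecidableEq κ] [Zero R] (J : Finset κ) (s : κ → R) : κ → R :=
  fun k => if k ∈ J then s k else 0

/-- The nonlinear operator `Λ`: the sum over all set partitions `α` of the index set `κ` of
`partitionCoeff α` times the product over the parts `J` of `α` of `h ∘ zeroOutside J`. -/
def Lambda {κ R : Type*} [Fintype κ] [DecidableEq κ] [Zero R] (h : (κ → R) → ℂ) (s : κ → R) : ℂ :=
  ∑ α : Finpartition (Finset.univ : Finset κ),
    partitionCoeff α * ∏ J ∈ α.parts, h (zeroOutside J s)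

/-- The cumulative distribution function `z ↦ P (Z ≤ z)` of a random vector `Z`; the order on
`ι → ℝ` is the componentwise one. -/
def cdfVec {Ω ι : Type*} [MeasurableSpace Ω] (P : Measure Ω) (Z : Ω → ι → ℝ) (z : ι → ℝ) : ℝ :=
  P.real {ω | Z ω ≤ z}

/-- The characteristic function `t ↦ E (exp (i ∑ j, t j * Z j))` of a random vector `Z`: the
characteristic function of the law of `Z`, transported to the Euclidean space. -/
def charFunVec {Ω ι : Type*} [Fintype ι] [MeasurableSpace Ω] (P : Measure Ω) (Z : Ω → ι → ℝ)
    (t : ι → ℝ) : ℂ :=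
  charFun (P.map fun ω => (WithLp.toLp 2 (Z ω) : EuclideanSpace ℝ ι)) (WithLp.toLp 2 t)

/-- The subvector of `Z` formed by the coordinates in `J`. -/
def marginal {Ω ι : Type*} (J : Finset ι) (Z : Ω → ι → ℝ) : Ω → J → ℝ :=
  fun ω j => Z ω j

/-- The uniform distance of the distribution functions of two random vectors. -/
def cdfDist {Ω Ω' ι : Type*} [MeasurableSpace Ω] [MeasurableSpace Ω'] (P : Measure Ω)
    (P' : Measure Ω') (X : Ω → ι → ℝ) (Y : Ω' → ι → ℝ) : ℝ≥0∞ :=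
  ⨆ z : ι → ℝ, ENNReal.ofReal |cdfVec P X z - cdfVec P' Y z|

/-- The supremum of the `j`-th partial derivative of the distribution function of `Y`, possibly
infinite. (Distribution functions are nondecreasing in each variable, so the partial derivatives
are nonnegative.) -/
def supPartialDeriv {Ω ι : Type*} [Fintype ι] [DecidableEq ι] [MeasurableSpace Ω] (P : Measure Ω)
    (Y : Ω → ι → ℝ) (j : ι) : ℝ≥0∞ :=
  ⨆ y : ι → ℝ, ENNReal.ofReal (fderiv ℝ (cdfVec P Y) y (Pi.single j 1))

/-- The Fubini numbers (ordered Bell numbers), for `1 ≤ j`. -/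
def fubini (j : ℕ) : ℕ :=
  ∑ k ∈ Finset.Icc 1 j, Nat.stirlingSecond j k * k.factorial

/-- The constant `C₁`, the real cube root of `32 / (π (1 - (3/4)^(1/m)))`. -/
def C₁ (m : ℕ) : ℝ :=
  (32 / (Real.pi * (1 - (3 / 4 : ℝ) ^ (1 / (m : ℝ))))) ^ (1 / 3 : ℝ)

/-- The constant `C₂`. -/
def C₂ : ℝ := 12 / Real.pi

/-- The integral over the maximum-norm ball of radius `T` of
`|(Λ(φ_X) - Λ(φ_Y))(t) / ∏ ℓ, t ℓ|`, as an element of `[0, ∞]`. -/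
def lambdaIntegral {Ω Ω' ι : Type*} [Fintype ι] [DecidableEq ι] [MeasurableSpace Ω]
    [MeasurableSpace Ω'] (P : Measure Ω) (P' : Measure Ω') (X : Ω → ι → ℝ) (Y : Ω' → ι → ℝ)
    (T : ℝ) : ℝ≥0∞ :=
  ∫⁻ t : ι → ℝ in {t | ‖t‖ ≤ T},
    ‖(Lambda (charFunVec P X) t - Lambda (charFunVec P' Y) t) / ((∏ ℓ, t ℓ : ℝ) : ℂ)‖ₑ

end BerryEsseen

end

/-! Smooth both laws and invert the Fourier transform, but apply the inversion to a signed
combination of laws whose characteristic function vanishes on the coordinate hyperplanes, so that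
division by `∏ t l` becomes harmless.

For a set partition `α`, let `blockMeasure ρ α` be the law that keeps the marginals of `ρ` on the
blocks and makes the blocks independent. Its characteristic function is the product of `φ ∘ ψ_J`
over the blocks, so `Λ(φ)` is the characteristic function of the signed measure obtained by
weighting the block laws with `partitionCoeff` (`Lambda_charFunPi`). The one-block partition
contributes `ρ` itself with weight 1. Every other term has a distribution function that is a product
of proper marginals; by telescoping, its change from `μ` to `ν` is at most the sum of the marginal
distances. Collecting by blocks, `J` receives the sum of `(|α| - 1)!` over partitions containing
`J`, which is at most the Fubini number of `m - |J|` (`sum_factorial_parts_le`, `abs_conv_sub_le`).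

The smoothing law is a product of Jackson kernels whose characteristic functions live on `[-T, T]`.
Inversion over boxes `(-n, z]` followed by Riemann-Lebesgue as `n → ∞` bounds the smoothed
combination by the integral of `|f / ∏ t l|` (`norm_sum_conv_le`). Smoothing is undone by
`abs_sub_le`: a cube of radius of order `1/T` carries at least 3/4 of the smoothing mass, and on it
monotonicity of one distribution function and the Lipschitz bound of the other control the
difference. This costs the factor 2 and the term with `C₁ + C₂`.

For finiteness, `Λ(φ_X) - Λ(φ_Y)` vanishes whenever some `t l = 0`, and first moments make it
Lipschitz in each coordinate. It is therefore `O(min |t l|)`, hence `O(∏ |t l|^(1/m))`, and `|t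
l|^(1/m - 1)` is integrable at the origin. -/

noncomputable section

namespace BerryEsseen


/-! ### Set partitions: recursion on one point, Stirling and Fubini numbers. -/

section Partitions

variable {κ : Type*} [DecidableEq κ]

theorem sdiff_singleton_eq_of_notMem {s : Finset κ} {a : κ} (h : a ∉ s) : s \ {a} = s := by
  rw [Finset.sdiff_singleton_eq_erase, Finset.erase_eq_of_notMem h]

/-- Delete the point `a` from a partition of `insert a s`. -/
def deletePoint {s : Finset κ} {a : κ} (ha : a ∉ s) (α : Finpartition (insert a s)) :
    Finpartition s :=
  (α.avoid {a}).copy (by ext x; simp; grind)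

theorem mem_deletePoint {s : Finset κ} {a : κ} (ha : a ∉ s) (α : Finpartition (insert a s))
    (c : Finset κ) :
    c ∈ (deletePoint ha α).parts ↔ ∃ d ∈ α.parts, ¬ d ⊆ {a} ∧ d \ {a} = c := by
  unfold deletePoint
  rw [Finpartition.copy_parts, Finpartition.mem_avoid]

/-- Add the point `a` to the block `B` of a partition of `s`. -/
def addToBlock {s : Finset κ} {a : κ} (ha : a ∉ s) (β : Finpartition s) (B : Finset κ)
    (hB : B ∈ β.parts) : Finpartition (insert a s) :=
  Finpartition.ofExistsUnique (insert (insert a B) (β.parts.erase B))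
    (by
      intro p hp
      have h1 := β.subset hB
      rcases Finset.mem_insert.1 hp with rfl | hp
      · exact Finset.insert_subset_insert a h1
      · exact (β.subset (Finset.mem_of_mem_erase hp)).trans (Finset.subset_insert _ _))
    (by
      intro x hx
      have hsub : ∀ C ∈ β.parts, a ∉ C := fun C hC h => ha (β.subset hC h)
      rcases Finset.mem_insert.1 hx with rfl | hx
      · refine ⟨insert x B, by simp, ?_⟩
        rintro t ⟨ht, hxt⟩
        grind
      · obtain ⟨t, ht, hxt⟩ := β.exists_mem hx
        by_cases htB : t = B
        · subst htB
          refine ⟨insert a t, by simp [hxt], ?_⟩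
          rintro u ⟨hu, hxu⟩
          have this {B C : Finset κ} {x : κ} := β.eq_of_mem_parts (t := B) (u := C) (a := x)
          grind
        · refine ⟨t, by simp [hxt, ht, htB], ?_⟩
          rintro u ⟨hu, hxu⟩
          have this {B C : Finset κ} {x : κ} := β.eq_of_mem_parts (t := B) (u := C) (a := x)
          grind)
    (by
      have h0 := β.empty_notMem_parts
      intro h
      rcases Finset.mem_insert.1 h with h | h
      · exact (Finset.insert_ne_empty _ _) h.symm
      · exact h0 (Finset.mem_of_mem_erase h))

/-- The new point either forms a block of its own or joins exactly one existing block. Taking `F` as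
a function of the set of blocks lets partitions of different sets be compared without casts. -/
theorem sum_finpartition_insert {M : Type*} [AddCommMonoid M] {s : Finset κ} {a : κ} (ha : a ∉ s)
    (F : Finset (Finset κ) → M) :
    ∑ α : Finpartition (insert a s), F α.parts =
      ∑ β : Finpartition s, (F (insert {a} β.parts) +
        ∑ B ∈ β.parts, F (insert (insert a B) (β.parts.erase B))) := by
  classical
  rw [Finset.sum_add_distrib,
    ← Finset.sum_filter_add_sum_filter_not Finset.univ
      (fun α : Finpartition (insert a s) => {a} ∈ α.parts)]
  congr 1
  · refine Finset.sum_bij' (fun α _ => deletePoint ha α)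
      (fun β _ => β.extend (b := {a}) (by simp) (by simpa using ha)
        (by ext; simp)) (by simp) (by simp) ?_ ?_ ?_
    · intro α hα
      have hα' : {a} ∈ α.parts := by simpa using hα
      ext c
      rw [Finpartition.extend_parts, Finset.mem_insert, mem_deletePoint]
      have this {B C : Finset κ} {x : κ} := α.eq_of_mem_parts (t := B) (u := C) (a := x)
      have h0 := α.empty_notMem_parts
      constructor
      · rintro (rfl | ⟨d, hd, h1, rfl⟩)
        · exact hα'
        · have had : a ∉ d := fun h => h1 (by rw [this hd hα' h (by simp)])
          rwa [sdiff_singleton_eq_of_notMem had]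
      · intro hc
        by_cases h : c = {a}
        · exact Or.inl h
        · refine Or.inr ⟨c, hc, ?_, ?_⟩
          · intro h'
            rcases Finset.subset_singleton_iff.1 h' with h' | h'
            · exact h0 (h' ▸ hc)
            · exact h h'
          · apply sdiff_singleton_eq_of_notMem
            intro h'
            exact h (this hc hα' h' (by simp))
    · intro β _
      ext c
      rw [mem_deletePoint]
      have hsub : ∀ C ∈ β.parts, a ∉ C := fun C hC h => ha (β.subset hC h)
      have h0 := β.empty_notMem_parts
      simp only [Finpartition.extend_parts, Finset.mem_insert]
      constructor
      · rintro ⟨d, rfl | hd, h1, rfl⟩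
        · simp at h1
        · rwa [sdiff_singleton_eq_of_notMem (hsub d hd)]
      · intro hc
        refine ⟨c, Or.inr hc, ?_, sdiff_singleton_eq_of_notMem (hsub c hc)⟩
        intro h'
        rcases Finset.subset_singleton_iff.1 h' with h' | h'
        · exact h0 (h' ▸ hc)
        · exact hsub c hc (by simp [h'])
    · intro α hα
      have hα' : {a} ∈ α.parts := by simpa using hα
      congr 1
      ext c
      rw [Finset.mem_insert, mem_deletePoint]
      have this {B C : Finset κ} {x : κ} := α.eq_of_mem_parts (t := B) (u := C) (a := x)
      have h0 := α.empty_notMem_parts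
      constructor
      · intro hc
        by_cases h : c = {a}
        · exact Or.inl h
        · refine Or.inr ⟨c, hc, ?_, ?_⟩
          · intro h'
            rcases Finset.subset_singleton_iff.1 h' with h' | h'
            · exact h0 (h' ▸ hc)
            · exact h h'
          · apply sdiff_singleton_eq_of_notMem
            intro h'
            exact h (this hc hα' h' (by simp))
      · rintro (rfl | ⟨d, hd, h1, rfl⟩)
        · exact hα'
        · have had : a ∉ d := fun h => h1 (by rw [this hd hα' h (by simp)])
          rwa [sdiff_singleton_eq_of_notMem had]
  -- Partitions in which `a` is not alone correspond to pairs `(β, B)`: delete `a`, and remember the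
  -- block `B` from which it was deleted.
  · rw [Finset.sum_sigma']
    have key : ∀ α : Finpartition (insert a s), {a} ∉ α.parts →
        α.part a \ {a} ∈ (deletePoint ha α).parts ∧
        insert (insert a (α.part a \ {a})) ((deletePoint ha α).parts.erase (α.part a \ {a}))
          = α.parts := by
      intro α hα
      have hA : α.part a ∈ α.parts := by simp
      have haA : a ∈ α.part a := by simp
      have hd {B C : Finset κ} {x : κ} := α.eq_of_mem_parts (t := B) (u := C) (a := x)
      have h0 := α.empty_notMem_parts
      have hns : ∀ d ∈ α.parts, ¬ d ⊆ {a} := by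
        intro d hd h'
        rcases Finset.subset_singleton_iff.1 h' with h' | h'
        · exact h0 (h' ▸ hd)
        · exact hα (h' ▸ hd)
      generalize α.part a = A at *
      have hna : ∀ d ∈ α.parts, d ≠ A → d \ {a} = d := fun d hd' hne =>
        sdiff_singleton_eq_of_notMem (fun h => hne (hd hd' hA h haA))
      refine ⟨(mem_deletePoint ha α _).2 ⟨A, hA, hns A hA, rfl⟩, ?_⟩
      have hAA : insert a (A \ {a}) = A := by ext x; simp; grind
      rw [hAA]
      ext c
      rw [Finset.mem_insert, Finset.mem_erase, mem_deletePoint]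
      constructor
      · rintro (rfl | ⟨h1, d, hd', -, rfl⟩)
        · exact hA
        · have : d ≠ A := by rintro rfl; exact h1 rfl
          rwa [hna d hd' this]
      · intro hc
        by_cases h : c = A
        · exact Or.inl h
        · refine Or.inr ⟨?_, c, hc, hns c hc, hna c hc h⟩
          intro hcA
          obtain ⟨x, hx⟩ := α.nonempty_of_mem_parts hc
          exact h (hd hc hA hx (by grind))
    refine Finset.sum_bij' (fun α _ => (⟨deletePoint ha α, α.part a \ {a}⟩ :
        Σ _ : Finpartition s, Finset κ))
      (fun x hx => addToBlock ha x.1 x.2 (by simpa using hx)) ?_ ?_ ?_ ?_ ?_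
    · intro α hα
      simpa using (key α (by simpa using hα)).1
    · rintro ⟨β, B⟩ hx
      have hB : B ∈ β.parts := by simpa using hx
      have hsub : ∀ C ∈ β.parts, a ∉ C := fun C hC h => ha (β.subset hC h)
      have hBne := β.nonempty_of_mem_parts hB
      simp only [Finset.mem_filter, Finset.mem_univ, true_and, addToBlock,
        Finpartition.ofExistsUnique_parts, Finset.mem_insert, Finset.mem_erase, not_or]
      refine ⟨fun h => ?_, fun h => hsub _ h.2 (by simp)⟩
      obtain ⟨x, hx⟩ := hBne
      have : x ∈ ({a} : Finset κ) := by rw [h]; simp [hx]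
      rw [Finset.mem_singleton] at this
      exact hsub B hB (this ▸ hx)
    · intro α hα
      ext1
      simpa [addToBlock] using (key α (by simpa using hα)).2
    · rintro ⟨β, B⟩ hx
      have hB : B ∈ β.parts := by simpa using hx
      have hsub : ∀ C ∈ β.parts, a ∉ C := fun C hC h => ha (β.subset hC h)
      have hBne := β.nonempty_of_mem_parts hB
      have h0 := β.empty_notMem_parts
      have hpart : (addToBlock ha β B hB).part a = insert a B :=
        Finpartition.part_eq_of_mem _ (by simp [addToBlock]) (by simp)
      have hBB : insert a B \ {a} = B := by
        have := hsub B hB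
        ext x; simp; grind
      have hns : ∀ d ∈ β.parts, ¬ d ⊆ {a} := by
        intro d hd h'
        rcases Finset.subset_singleton_iff.1 h' with h' | h'
        · exact h0 (h' ▸ hd)
        · exact hsub d hd (by simp [h'])
      refine Sigma.ext ?_ (heq_of_eq ?_)
      · ext c
        simp only
        rw [mem_deletePoint]
        simp only [addToBlock, Finpartition.ofExistsUnique_parts, Finset.mem_insert,
          Finset.mem_erase]
        constructor
        · rintro ⟨d, rfl | ⟨-, hd⟩, -, rfl⟩
          · rwa [hBB]
          · rwa [sdiff_singleton_eq_of_notMem (hsub d hd)]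
        · intro hc
          by_cases h : c = B
          · subst h
            exact ⟨insert a c, Or.inl rfl, fun h' => hns c hc ((Finset.subset_insert _ _).trans h'),
              hBB⟩
          · exact ⟨c, Or.inr ⟨h, hc⟩, hns c hc, sdiff_singleton_eq_of_notMem (hsub c hc)⟩
      · simp only
        rw [hpart, hBB]
    · intro α hα
      rw [(key α (by simpa using hα)).2]

theorem card_parts_addToBlock {s : Finset κ} {a : κ} (ha : a ∉ s) (β : Finpartition s)
    {B : Finset κ} (hB : B ∈ β.parts) :
    (insert (insert a B) (β.parts.erase B)).card = β.parts.card := by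
  rw [Finset.card_insert_of_notMem, Finset.card_erase_of_mem hB]
  · have : 0 < β.parts.card := Finset.card_pos.2 ⟨B, hB⟩
    omega
  · intro h
    exact ha (β.subset (Finset.mem_of_mem_erase h) (by simp))

theorem singleton_notMem_parts {s : Finset κ} {a : κ} (ha : a ∉ s) (β : Finpartition s) :
    {a} ∉ β.parts := fun h => ha (β.subset h (by simp))

/-- The number of partitions of an `n`-element set into `k` blocks is a Stirling number of the
second kind. -/
theorem sum_finpartition_card_eq (s : Finset κ) (k : ℕ) :
    ∑ α : Finpartition s, (if α.parts.card = k then 1 else 0) = Nat.stirlingSecond s.card k := by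
  classical
  induction s using Finset.induction_on generalizing k with
  | empty =>
    have h : ∀ α : Finpartition (∅ : Finset κ), α.parts = ∅ := fun α =>
      α.parts_eq_empty_iff.2 rfl
    have hu : (Finset.univ : Finset (Finpartition (∅ : Finset κ))) = {Finpartition.empty _} :=
      Finset.eq_singleton_iff_unique_mem.2 ⟨Finset.mem_univ _, fun x _ => by
        ext1; rw [h, h]⟩
    rw [hu, Finset.sum_singleton, h]
    cases k <;> simp
  | insert a s ha ih =>
    -- The two cases for the new point are the two summands of the Stirling recurrence: joining a
    -- block keeps the number of blocks and can be done in `k` ways.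
    rw [sum_finpartition_insert ha (fun p => if p.card = k then 1 else 0),
      Finset.card_insert_of_notMem ha]
    have h1 : ∀ β : Finpartition s, (insert {a} β.parts).card = β.parts.card + 1 := fun β =>
      Finset.card_insert_of_notMem (singleton_notMem_parts ha β)
    have h2 : ∀ β : Finpartition s, ∑ B ∈ β.parts,
        (if (insert (insert a B) (β.parts.erase B)).card = k then 1 else 0)
        = k * (if β.parts.card = k then 1 else 0) := by
      intro β
      rw [Finset.sum_congr rfl (fun B hB => by rw [card_parts_addToBlock ha β hB])]
      split_ifs with h <;> simp [h]
    simp only [h1, h2]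
    rw [Finset.sum_add_distrib, ← Finset.mul_sum, ih]
    cases k with
    | zero => simp
    | succ k =>
      simp only [Nat.add_right_cancel_iff]
      rw [ih, Nat.stirlingSecond_succ_succ, add_comm]

/-- Group the partitions by their number of blocks. Nonemptiness matters: the empty set has one
partition, with no blocks, while `fubini 0 = 0`. -/
theorem sum_factorial_card_parts (s : Finset κ) (hs : s.Nonempty) :
    ∑ α : Finpartition s, α.parts.card.factorial = fubini s.card := by
  unfold fubini
  have h : ∀ α : Finpartition s, α.parts.card.factorial =
      ∑ k ∈ Finset.Icc 1 s.card, (if α.parts.card = k then 1 else 0) * k.factorial := by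
    intro α
    rw [Finset.sum_eq_single_of_mem α.parts.card]
    · simp
    · rw [Finset.mem_Icc]
      exact ⟨Finset.card_pos.2 (α.parts_nonempty (by simpa using hs.ne_empty)),
        α.card_parts_le_card⟩
    · intro b _ hb
      simp [hb.symm]
  rw [Finset.sum_congr rfl (fun α _ => h α), Finset.sum_comm]
  refine Finset.sum_congr rfl fun k _ => ?_
  rw [← Finset.sum_mul, sum_finpartition_card_eq]

end Partitions

/-! ### Partitions containing a given block, and vanishing of `Λ` on hyperplanes. -/

section PartitionsUniv

variable {κ : Type*} [Fintype κ] [DecidableEq κ]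

/-- Remove the block `J` from a partition. -/
def removeBlock (α : Finpartition (Finset.univ : Finset κ)) (J : Finset κ) (hJ : J ∈ α.parts) :
    Finpartition Jᶜ :=
  α.ofSubset (parts := α.parts.erase J) (Finset.erase_subset _ _) (by
    ext x
    simp only [Finset.mem_sup, Finset.mem_erase, id, Finset.mem_compl]
    constructor
    · rintro ⟨C, ⟨h1, h2⟩, hx⟩ hxJ
      exact h1 (α.eq_of_mem_parts h2 hJ hx hxJ)
    · intro hx
      obtain ⟨C, hC, hxC⟩ := α.exists_mem (Finset.mem_univ x)
      exact ⟨C, ⟨by rintro rfl; exact hx hxC, hC⟩, hxC⟩)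

/-- Removing the block `J` is injective into the partitions of `Jᶜ` and lowers the number of blocks
by one, so `(|α| - 1)!` becomes `|β|!`. This is the source of the weights `B_{m-|J|}`. -/
theorem sum_factorial_parts_le (J : Finset κ) (hJ : J ≠ Finset.univ) :
    ∑ α : Finpartition (Finset.univ : Finset κ) with J ∈ α.parts,
      (α.parts.card - 1).factorial ≤ fubini (Fintype.card κ - J.card) := by
  classical
  rw [← Finset.card_compl, ← sum_factorial_card_parts Jᶜ (by
    rw [Finset.nonempty_iff_ne_empty, Ne, Finset.compl_eq_empty_iff]; exact hJ)]
  have hmem : ∀ α ∈ Finset.univ.filter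
      (fun α : Finpartition (Finset.univ : Finset κ) => J ∈ α.parts), J ∈ α.parts := by simp
  rw [← Finset.sum_attach]
  have hcard : ∀ α : Finpartition (Finset.univ : Finset κ), ∀ h : J ∈ α.parts,
      α.parts.card - 1 = (removeBlock α J h).parts.card := fun α h => by
    simp [removeBlock, Finset.card_erase_of_mem h]
  rw [Finset.sum_congr rfl (fun α _ => by rw [hcard α.1 (hmem _ α.2)])]
  refine (Finset.sum_image (f := fun β : Finpartition Jᶜ => β.parts.card.factorial)
      (s := Finset.attach _) (g := fun α : { x // x ∈ Finset.univ.filter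
        (fun α : Finpartition (Finset.univ : Finset κ) => J ∈ α.parts) } =>
        removeBlock α.1 J (hmem _ α.2)) ?_).symm.trans_le ?_
  rotate_left
  · exact Finset.sum_le_univ_sum_of_nonneg fun _ => Nat.zero_le _
  · rintro ⟨α, hα⟩ - ⟨β, hβ⟩ - h
    have h' : α.parts.erase J = β.parts.erase J := congrArg Finpartition.parts h
    ext1
    ext1
    rw [← Finset.insert_erase (hmem _ hα), h', Finset.insert_erase (hmem _ hβ)]

theorem partitionCoeff_norm (α : Finpartition (Finset.univ : Finset κ)) :
    ‖partitionCoeff α‖ = ((α.parts.card - 1).factorial : ℝ) := by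
  simp [partitionCoeff]

/-- When `t l = 0`, the products over blocks ignore `l`. Over a partition of the other points with
`k` blocks, isolating `l` gives the coefficient `(-1)^k k!`, and the `k` ways of joining it to a
block give `k (-1)^(k-1) (k-1)!`; these cancel. -/
theorem Lambda_eq_zero (h : (κ → ℝ) → ℂ) (h0 : h 0 = 1) (hκ : 2 ≤ Fintype.card κ) (t : κ → ℝ)
    {l : κ} (hl : t l = 0) : Lambda h t = 0 := by
  have hu : insert l (Finset.univ.erase l) = (Finset.univ : Finset κ) :=
    Finset.insert_erase (Finset.mem_univ l)
  have hns : l ∉ (Finset.univ.erase l : Finset κ) := by simp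
  have hcast : ∀ (F : Finset (Finset κ) → ℂ) (s : Finset κ), s = Finset.univ →
      ∑ α : Finpartition (Finset.univ : Finset κ), F α.parts = ∑ α : Finpartition s, F α.parts := by
    rintro F s rfl; rfl
  unfold Lambda partitionCoeff
  rw [hcast (fun p => (-1) ^ (p.card - 1) * ((p.card - 1).factorial : ℂ) *
    ∏ J ∈ p, h (zeroOutside J t)) _ hu, sum_finpartition_insert hns
    (fun p => (-1) ^ (p.card - 1) * ((p.card - 1).factorial : ℂ) * ∏ J ∈ p, h (zeroOutside J t))]
  refine Finset.sum_eq_zero fun β _ => ?_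
  have hz : h (zeroOutside {l} t) = 1 := by
    rw [← h0]; congr 1; ext k; by_cases hk : k = l <;> simp [zeroOutside, hk, hl]
  have hins : ∀ B, zeroOutside (insert l B) t = zeroOutside B t := by
    intro B; ext k; by_cases hk : k = l <;> simp [zeroOutside, hk, hl]
  -- Here two coordinates are needed: with `k = 0` there is no block to join and nothing cancels.
  have hc : 0 < β.parts.card := Finset.card_pos.2 (β.parts_nonempty (by
    rw [Finset.bot_eq_empty, ← Finset.card_pos.trans Finset.nonempty_iff_ne_empty,
      Finset.card_erase_of_mem (Finset.mem_univ l), Finset.card_univ]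
    omega))
  rw [Finset.card_insert_of_notMem (singleton_notMem_parts hns β),
    Finset.prod_insert (singleton_notMem_parts hns β), hz]
  have h2 : ∀ B ∈ β.parts,
      (-1 : ℂ) ^ ((insert (insert l B) (β.parts.erase B)).card - 1) *
        (((insert (insert l B) (β.parts.erase B)).card - 1).factorial : ℂ) *
        ∏ J ∈ insert (insert l B) (β.parts.erase B), h (zeroOutside J t)
      = (-1) ^ (β.parts.card - 1) * ((β.parts.card - 1).factorial : ℂ) *
        ∏ J ∈ β.parts, h (zeroOutside J t) := by
    intro B hB
    rw [card_parts_addToBlock hns β hB, Finset.prod_insert, hins,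
      Finset.mul_prod_erase _ (fun J => h (zeroOutside J t)) hB]
    intro h'
    exact hns (β.subset (Finset.mem_of_mem_erase h') (by simp))
  rw [Finset.sum_congr rfl h2, Finset.sum_const, nsmul_eq_mul]
  obtain ⟨n, hn⟩ : ∃ n, β.parts.card = n + 1 := ⟨β.parts.card - 1, by omega⟩
  rw [hn]
  simp only [Nat.add_sub_cancel, Nat.factorial_succ, pow_succ]
  push_cast
  ring

end PartitionsUniv


/-! ### The Jackson kernel: a density with band-limited characteristic function and cubic tails. -/

section Kernel

open Complex Set FourierTransform Filter

/-- The triangle function, with values in `ℂ`. -/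
def triangle (x : ℝ) : ℂ := ((max 0 (1 - |x|) : ℝ) : ℂ)

theorem continuous_triangle : Continuous triangle := by
  unfold triangle; fun_prop

theorem triangle_neg (x : ℝ) : triangle (-x) = triangle x := by simp [triangle]

theorem triangle_of_mem {x : ℝ} (h0 : 0 ≤ x) (h1 : x ≤ 1) : triangle x = 1 - x := by
  rw [triangle, abs_of_nonneg h0, max_eq_right (by linarith)]; push_cast; ring

theorem triangle_of_one_le {x : ℝ} (h : 1 ≤ |x|) : triangle x = 0 := by
  rw [triangle, max_eq_left (by linarith)]; simp

theorem support_triangle_subset : Function.support triangle ⊆ Ioo (-1) 1 := by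
  intro x hx
  by_contra h
  exact hx (triangle_of_one_le (by rw [mem_Ioo, ← abs_lt] at h; exact not_lt.1 h))

theorem hasCompactSupport_triangle : HasCompactSupport triangle :=
  HasCompactSupport.of_support_subset_isCompact isCompact_Icc
    (support_triangle_subset.trans Ioo_subset_Icc_self)

theorem integrable_triangle : Integrable triangle :=
  continuous_triangle.integrable_of_hasCompactSupport hasCompactSupport_triangle

theorem setIntegral_Ioi_of_zero {f : ℝ → ℂ} (hf : ∀ x, 1 ≤ x → f x = 0) :
    ∫ x in Ioi 0, f x = ∫ x in (0 : ℝ)..1, f x := by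
  rw [intervalIntegral.integral_of_le zero_le_one]
  refine setIntegral_eq_of_subset_of_forall_sdiff_eq_zero measurableSet_Ioi
    (fun x hx => hx.1) ?_
  rintro x ⟨hx0, hx1⟩
  exact hf x (by by_contra h; exact hx1 ⟨hx0, (not_le.1 h).le⟩)

theorem integral_triangle_exp (c : ℂ) (hc : c ≠ 0) :
    ∫ x : ℝ, exp (c * x) * triangle x = (exp c + exp (-c) - 2) / c ^ 2 := by
  have hint : ∀ c : ℂ, Integrable fun x : ℝ => exp (c * x) * triangle x := fun c =>
    (Continuous.mul (by fun_prop) continuous_triangle).integrable_of_hasCompactSupport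
      hasCompactSupport_triangle.mul_left
  have half : ∀ c : ℂ, c ≠ 0 → ∫ x in Ioi (0 : ℝ), exp (c * x) * triangle x
      = exp c / c ^ 2 - 1 / c - 1 / c ^ 2 := by
    intro c hc
    rw [setIntegral_Ioi_of_zero (f := fun x => exp (c * x) * triangle x)
      (fun x hx => by rw [triangle_of_one_le (hx.trans (le_abs_self x)), mul_zero])]
    have hcongr : ∫ x in (0 : ℝ)..1, exp (c * x) * triangle x
        = ∫ x in (0 : ℝ)..1, exp (c * x) * (1 - x) := by
      refine intervalIntegral.integral_congr fun x hx => ?_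
      rw [uIcc_of_le zero_le_one] at hx
      simp only [triangle_of_mem hx.1 hx.2]
    rw [hcongr]
    have hderiv : ∀ x ∈ uIcc (0 : ℝ) 1, HasDerivAt
        (fun x : ℝ => ((1 - (x : ℂ)) / c + 1 / c ^ 2) * exp (c * x)) (exp (c * x) * (1 - x)) x := by
      intro x _
      have h1 : HasDerivAt (fun x : ℝ => (x : ℂ)) 1 x := Complex.ofRealCLM.hasDerivAt
      have h2 := (((h1.const_sub 1).div_const c).add_const (1 / c ^ 2)).mul (h1.const_mul c).cexp
      convert! h2 using 1
      field_simp
      ring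
    rw [intervalIntegral.integral_eq_sub_of_hasDerivAt hderiv
      (Continuous.intervalIntegrable (by fun_prop) _ _)]
    simp
    ring
  rw [← intervalIntegral.integral_Iic_add_Ioi (b := 0) (hint c).integrableOn (hint c).integrableOn,
    half c hc]
  have hneg : ∫ x in Iic (0 : ℝ), exp (c * x) * triangle x
      = ∫ x in Ioi (0 : ℝ), exp (-c * x) * triangle x := by
    have := integral_comp_neg_Iic 0 (fun x : ℝ => exp (-c * x) * triangle x)
    simpa [triangle_neg] using this
  rw [hneg, half (-c) (neg_ne_zero.2 hc)]
  field_simp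
  ring

theorem fourier_triangle_eq (ξ : ℝ) :
    𝓕 triangle ξ = ∫ x : ℝ, exp ((-2 * Real.pi * ξ * I : ℂ) * x) * triangle x := by
  rw [Real.fourier_real_eq_integral_exp_smul]
  congr 1; ext x
  rw [smul_eq_mul]; congr 2; push_cast; ring

theorem fourier_triangle_neg (ξ : ℝ) : 𝓕 triangle (-ξ) = 𝓕 triangle ξ := by
  rw [fourier_triangle_eq, fourier_triangle_eq,
    ← integral_neg_eq_self (fun x : ℝ => exp ((-2 * Real.pi * ξ * I : ℂ) * x) * triangle x)]
  congr 1; ext x; rw [triangle_neg]; congr 2; push_cast; ring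

/-- Because the transform is real, its squared modulus is its square, to which the convolution
theorem applies. -/
theorem fourier_triangle_conj (ξ : ℝ) :
    (starRingEnd ℂ) (𝓕 triangle ξ) = 𝓕 triangle ξ := by
  conv_rhs => rw [← fourier_triangle_neg ξ]
  rw [fourier_triangle_eq, fourier_triangle_eq, ← integral_conj]
  congr 1; ext x; rw [map_mul, ← exp_conj]
  congr 1
  · congr 1; simp [map_ofNat]
  · simp [triangle]

/-- In the closed form the numerator has modulus at most 4 and the denominator is `(2πξ)^2`. -/
theorem norm_fourier_triangle_le (ξ : ℝ) : ‖𝓕 triangle ξ‖ * ξ ^ 2 ≤ 1 / Real.pi ^ 2 := by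
  rcases eq_or_ne ξ 0 with rfl | h
  · simp; positivity
  have hπ := Real.pi_pos
  have hc : (-2 * Real.pi * ξ * I : ℂ) ≠ 0 := by
    simp [h, hπ.ne']
  rw [fourier_triangle_eq, integral_triangle_exp _ hc, norm_div, norm_pow]
  have h1 : ‖(-2 * Real.pi * ξ * I : ℂ)‖ ^ 2 = 4 * Real.pi ^ 2 * ξ ^ 2 := by
    simp only [norm_mul, norm_neg, norm_real, norm_I, Complex.norm_ofNat, Real.norm_eq_abs,
      mul_pow, sq_abs]
    ring
  rw [h1]
  have h2 : ‖exp (-2 * Real.pi * ξ * I : ℂ) + exp (-(-2 * Real.pi * ξ * I : ℂ)) - 2‖ ≤ 4 := by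
    have e1 : ‖exp (-2 * Real.pi * ξ * I : ℂ)‖ = 1 := by
      have := norm_exp_ofReal_mul_I (-2 * Real.pi * ξ); push_cast at this; exact this
    have e2 : ‖exp (-(-2 * Real.pi * ξ * I : ℂ))‖ = 1 := by
      have := norm_exp_ofReal_mul_I (-(-2 * Real.pi * ξ)); push_cast at this
      rw [← this]; congr 2; ring
    calc _ ≤ ‖exp (-2 * Real.pi * ξ * I : ℂ)‖ + ‖exp (-(-2 * Real.pi * ξ * I : ℂ))‖ + ‖(2:ℂ)‖ :=
          (norm_sub_le _ _).trans (by gcongr; exact norm_add_le _ _)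
      _ = 4 := by rw [e1, e2]; norm_num
  calc _ ≤ 4 / (4 * Real.pi ^ 2 * ξ ^ 2) * ξ ^ 2 := by gcongr
    _ = 1 / Real.pi ^ 2 := by field_simp

theorem continuous_fourier_triangle : Continuous (𝓕 triangle) :=
  VectorFourier.fourierIntegral_continuous Real.continuous_fourierChar
    (innerSL ℝ).continuous₂ integrable_triangle

theorem norm_fourier_triangle_le_integral (ξ : ℝ) : ‖𝓕 triangle ξ‖ ≤ ∫ x, ‖triangle x‖ :=
  VectorFourier.norm_fourierIntegral_le_integral_norm _ _ _ _ _

/-- The square of the Fourier transform of the triangle function, normalized to be a probability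
density. -/
def jackson (ξ : ℝ) : ℝ := 3 / 2 * ‖𝓕 triangle ξ‖ ^ 2

theorem jackson_nonneg (ξ : ℝ) : 0 ≤ jackson ξ := by unfold jackson; positivity

theorem jackson_neg (ξ : ℝ) : jackson (-ξ) = jackson ξ := by
  rw [jackson, fourier_triangle_neg, jackson]

theorem continuous_jackson : Continuous jackson := by
  unfold jackson
  exact continuous_const.mul (continuous_fourier_triangle.norm.pow 2)

theorem ofReal_jackson (ξ : ℝ) : (jackson ξ : ℂ) = 3 / 2 * 𝓕 triangle ξ ^ 2 := by
  rw [jackson]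
  push_cast
  congr 1
  rw [← Complex.mul_conj', fourier_triangle_conj, sq]

theorem integrable_jackson : Integrable jackson := by
  set M := ∫ x, ‖triangle x‖
  refine ((integrable_inv_one_add_sq).const_mul (3 / 2 * (M ^ 2 + M * (1 / Real.pi ^ 2)))).mono'
    continuous_jackson.aestronglyMeasurable (Eventually.of_forall fun ξ => ?_)
  rw [Real.norm_of_nonneg (jackson_nonneg ξ), jackson, mul_assoc]
  gcongr
  rw [← div_eq_mul_inv, le_div_iff₀ (by positivity)]
  have h1 := norm_fourier_triangle_le_integral ξ
  have h2 := norm_fourier_triangle_le ξ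
  have h0 := norm_nonneg (𝓕 triangle ξ)
  have h3 := mul_le_mul h1 h2 (by positivity) (h0.trans h1)
  have h4 := pow_le_pow_left₀ h0 h1 2
  linear_combination h3 + h4

theorem jackson_le {ξ : ℝ} (hξ : 0 < ξ) : jackson ξ ≤ 3 / 2 / Real.pi ^ 4 * ξ ^ (-4 : ℝ) := by
  have h2 := norm_fourier_triangle_le ξ
  have h3 := pow_le_pow_left₀ (by positivity) h2 2
  rw [jackson, Real.rpow_neg hξ.le, show (4 : ℝ) = ((4 : ℕ) : ℝ) by norm_num, Real.rpow_natCast,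
    ← div_eq_mul_inv, le_div_iff₀ (by positivity)]
  calc _ = 3 / 2 * (‖𝓕 triangle ξ‖ * ξ ^ 2) ^ 2 := by ring
    _ ≤ 3 / 2 * (1 / Real.pi ^ 2) ^ 2 := by gcongr
    _ = _ := by field_simp

theorem setIntegral_abs_gt {f : ℝ → ℝ} (hf : ∀ x, f (-x) = f x) {h : ℝ} (hh : 0 ≤ h) :
    ∫ x in {x | h < |x|}, f x = 2 * ∫ x in Ioi h, f x := by
  have h1 := integral_comp_abs (f := (Ioi h).indicator f)
  rw [setIntegral_indicator measurableSet_Ioi, Ioi_inter_Ioi, max_eq_right hh] at h1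
  rw [← h1, ← integral_indicator (measurableSet_lt measurable_const (by fun_prop))]
  congr 1; ext x
  simp only [indicator, mem_ofPred_eq, mem_Ioi]
  split_ifs
  · rcases abs_choice x with e | e <;> simp [e, hf]
  · rfl

theorem setIntegral_jackson_le {h : ℝ} (hh : 0 < h) :
    ∫ x in {x | h < |x|}, jackson x ≤ 1 / (Real.pi ^ 4 * h ^ 3) := by
  rw [setIntegral_abs_gt jackson_neg hh.le]
  have h1 : ∫ x in Ioi h, jackson x ≤ ∫ x in Ioi h, 3 / 2 / Real.pi ^ 4 * x ^ (-4 : ℝ) :=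
    setIntegral_mono_on integrable_jackson.integrableOn
      ((integrableOn_Ioi_rpow_of_lt (by norm_num) hh).const_mul _) measurableSet_Ioi
      fun x hx => jackson_le (hh.trans hx)
  rw [integral_const_mul, integral_Ioi_rpow_of_lt (by norm_num) hh] at h1
  refine (mul_le_mul_of_nonneg_left h1 zero_le_two).trans_eq ?_
  rw [show (-4 + 1 : ℝ) = -((3 : ℕ) : ℝ) by norm_num, Real.rpow_neg hh.le, Real.rpow_natCast]
  have hπ := Real.pi_pos
  push_cast
  field_simp

open scoped Convolution

/-- The characteristic function of the density `jackson`. -/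
def spline : ℝ → ℂ := fun t => 3 / 2 * (triangle ⋆[ContinuousLinearMap.mul ℂ ℂ] triangle) t

theorem continuous_spline : Continuous spline :=
  continuous_const.mul (hasCompactSupport_triangle.continuous_convolution_right _
    integrable_triangle.locallyIntegrable continuous_triangle)

theorem integrable_spline : Integrable spline :=
  (integrable_triangle.integrable_convolution _ integrable_triangle).const_mul _

theorem spline_eq_zero {t : ℝ} (ht : 2 < |t|) : spline t = 0 := by
  have h : t ∉ Function.support (triangle ⋆[ContinuousLinearMap.mul ℂ ℂ] triangle) := by
    intro h
    obtain ⟨a, ha, b, hb, rfl⟩ := support_convolution_subset _ h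
    have ha := abs_lt.2 (support_triangle_subset ha)
    have hb := abs_lt.2 (support_triangle_subset hb)
    have := abs_add_le a b
    simp only at ht
    linarith
  rw [spline, Function.notMem_support.1 h, mul_zero]

/-- The convolution theorem turns the self-convolution of the triangle into the square of its
transform. Support in `[-2, 2]` for `spline` thus coexists with nonnegativity of `jackson`. -/
theorem fourier_spline : 𝓕 spline = fun ξ => (jackson ξ : ℂ) := by
  ext ξ
  rw [ofReal_jackson, sq, ← Real.fourier_mul_convolution_eq integrable_triangle integrable_triangle,
    Real.fourier_real_eq, Real.fourier_real_eq, ← integral_const_mul]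
  congr 1; ext x
  rw [spline, Circle.smul_def, Circle.smul_def, smul_eq_mul, smul_eq_mul]
  ring

theorem fourierInv_jackson : 𝓕⁻ (fun ξ => (jackson ξ : ℂ)) = spline := by
  rw [← fourier_spline]
  exact continuous_spline.fourierInv_fourier_eq integrable_spline
    (by rw [fourier_spline]; exact integrable_jackson.ofReal)

/-- The integral of the squared triangle is 2/3, which explains the normalization 3/2. -/
theorem spline_zero : spline 0 = 1 := by
  rw [spline, convolution_def]
  have h1 : ∀ t, (ContinuousLinearMap.mul ℂ ℂ (triangle t)) (triangle (0 - t))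
      = triangle |t| ^ 2 := by
    intro t
    rw [ContinuousLinearMap.mul_apply', zero_sub, triangle_neg, sq]
    simp [triangle]
  simp only [h1]
  have h2 : ∫ x in Ioi (0:ℝ), triangle x ^ 2 = 1 / 3 := by
    rw [setIntegral_Ioi_of_zero (f := fun x => triangle x ^ 2)
      (fun x hx => by rw [triangle_of_one_le (hx.trans (le_abs_self x)), zero_pow two_ne_zero])]
    have hcongr : ∫ x in (0 : ℝ)..1, triangle x ^ 2
        = ∫ x in (0 : ℝ)..1, (((1 - x) ^ 2 : ℝ) : ℂ) := by
      refine intervalIntegral.integral_congr fun x hx => ?_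
      rw [uIcc_of_le zero_le_one] at hx
      simp only [triangle_of_mem hx.1 hx.2]
      push_cast; ring
    rw [hcongr, intervalIntegral.integral_ofReal,
      intervalIntegral.integral_comp_sub_left (fun x => x ^ 2) 1, integral_pow]
    norm_num
  have hc : Integrable fun x => triangle x ^ 2 :=
    (continuous_triangle.pow 2).integrable_of_hasCompactSupport (by
      simpa [sq] using hasCompactSupport_triangle.mul_left (f := triangle))
  have h3 : ∫ x : ℝ, triangle |x| ^ 2 = ∫ x : ℝ, triangle x ^ 2 := by
    congr 1; ext x; simp [triangle]
  have h4 : ∫ x in Iic (0:ℝ), triangle x ^ 2 = ∫ x in Ioi (0:ℝ), triangle x ^ 2 := by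
    have := integral_comp_neg_Iic 0 (fun x : ℝ => triangle x ^ 2)
    simpa [triangle_neg] using this
  rw [h3, ← intervalIntegral.integral_Iic_add_Ioi (b := 0) hc.integrableOn hc.integrableOn, h4, h2]
  norm_num

theorem integral_jackson : ∫ ξ, jackson ξ = 1 := by
  have h := congrFun fourierInv_jackson 0
  rw [spline_zero, Real.fourierInv_eq'] at h
  simp only [inner_zero_right, mul_zero, ofReal_zero, zero_mul, exp_zero, one_smul] at h
  rw [integral_complex_ofReal] at h
  exact_mod_cast h

theorem norm_spline_le (t : ℝ) : ‖spline t‖ ≤ 1 := by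
  rw [← fourierInv_jackson, Real.fourierInv_eq_fourier_neg, ← integral_jackson]
  refine (VectorFourier.norm_fourierIntegral_le_integral_norm _ _ _ _ _).trans_eq ?_
  congr 1; ext x; simp [abs_of_nonneg (jackson_nonneg x)]

/-- `v` is a symmetric probability density with characteristic function `g` supported in
`[-T, T]` and with tails of cubic decay. -/
structure IsSmoothingDensity (T : ℝ) (v : ℝ → ℝ) (g : ℝ → ℂ) : Prop where
  continuous : Continuous v
  nonneg : ∀ y, 0 ≤ v y
  integrable : Integrable v
  integral_eq_one : ∫ y, v y = 1
  symm : ∀ y, v (-y) = v y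
  continuous_cf : Continuous g
  norm_cf_le : ∀ t, ‖g t‖ ≤ 1
  cf_eq_zero : ∀ t, T < |t| → g t = 0
  eq_integral : ∀ y, (v y : ℂ) = 1 / (2 * Real.pi) * ∫ t, g t * exp (-(t * y * I))
  tail_le : ∀ h, 0 < h → ∫ y in {y | h < |y|}, v y ≤ 64 / (Real.pi * (T * h) ^ 3)

/-- A symmetric probability density with characteristic function supported in `[-T, T]`. -/
theorem exists_smoothing_density (T : ℝ) (hT : 0 < T) :
    ∃ (v : ℝ → ℝ) (g : ℝ → ℂ), IsSmoothingDensity T v g := by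
  have hπ := Real.pi_pos
  -- The density `a * jackson (a * y)` has characteristic function `spline (t / (2πa))`; this `a`
  -- turns the argument into `2t/T`, so the support `[-2, 2]` becomes `[-T, T]`.
  set a : ℝ := T / (4 * Real.pi) with ha
  have ha0 : 0 < a := by positivity
  refine ⟨fun y => a * jackson (a * y), fun t => spline (2 / T * t),
    continuous_const.mul (continuous_jackson.comp (by fun_prop)),
    fun y => mul_nonneg ha0.le (jackson_nonneg _),
    (integrable_jackson.comp_mul_left' ha0.ne').const_mul _, ?_, ?_,
    continuous_spline.comp (by fun_prop), fun t => norm_spline_le _, ?_, ?_, ?_⟩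
  · rw [integral_const_mul, Measure.integral_comp_mul_left, integral_jackson,
      abs_of_pos (by positivity), smul_eq_mul]
    field_simp
  · intro y
    simp only [mul_neg, jackson_neg]
  · intro t ht
    refine spline_eq_zero ?_
    rw [abs_mul, abs_of_pos (by positivity)]
    calc (2 : ℝ) = 2 / T * T := by field_simp
      _ < _ := by gcongr
  · intro y
    have h1 := congrFun fourier_spline (a * y)
    rw [Real.fourier_real_eq_integral_exp_smul] at h1
    have h2 := Measure.integral_comp_mul_left
      (fun t : ℝ => exp (((-2 * Real.pi * t * (a * y) : ℝ) : ℂ) * I) • spline t) (2 / T)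
    rw [h1, abs_of_pos (by positivity)] at h2
    have h3 : ∫ t : ℝ, spline (2 / T * t) * exp (-(t * y * I)) = ∫ x : ℝ,
        (fun t : ℝ => exp (((-2 * Real.pi * t * (a * y) : ℝ) : ℂ) * I) • spline t) (2 / T * x) := by
      congr 1; ext x
      simp only
      rw [smul_eq_mul, mul_comm]
      congr 2
      have : (-2 * Real.pi * (2 / T * x) * (a * y) : ℝ) = - (x * y) := by
        rw [ha]; field_simp; ring
      rw [this]; push_cast; ring
    rw [h3, h2, real_smul, ← mul_assoc]
    push_cast
    congr 1
    rw [ha]; push_cast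
    have hTc : (T : ℂ) ≠ 0 := by exact_mod_cast hT.ne'
    have hpc : (Real.pi : ℂ) ≠ 0 := by exact_mod_cast hπ.ne'
    field_simp
    norm_num
  · intro h hh
    rw [setIntegral_abs_gt (fun y => by simp only [mul_neg, jackson_neg]) hh.le, integral_const_mul,
      integral_comp_mul_left_Ioi _ _ ha0, smul_eq_mul, mul_inv_cancel_left₀ ha0.ne',
      ← setIntegral_abs_gt jackson_neg (by positivity)]
    refine (setIntegral_jackson_le (by positivity)).trans_eq ?_
    rw [ha]
    field_simp
    norm_num

end Kernel


/-! ### Fourier inversion for smoothed distribution functions. -/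

section Inversion

open Complex Set Filter Topology

variable {ι : Type*} [Fintype ι] {T : ℝ} {v : ℝ → ℝ} {g : ℝ → ℂ}

/-- The measure on `ℝ` with density `v`. -/
def densityMeasure (v : ℝ → ℝ) : Measure ℝ := volume.withDensity fun y => ENNReal.ofReal (v y)

/-- The product measure whose factors have density `v`. -/
def densityPi (ι : Type*) [Fintype ι] (v : ℝ → ℝ) : Measure (ι → ℝ) :=
  Measure.pi fun _ => densityMeasure v

theorem IsSmoothingDensity.isProbabilityMeasure (h : IsSmoothingDensity T v g) :
    IsProbabilityMeasure (densityMeasure v) := by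
  constructor
  rw [densityMeasure, withDensity_apply _ MeasurableSet.univ, Measure.restrict_univ,
    ← ofReal_integral_eq_lintegral_ofReal h.integrable (Eventually.of_forall h.nonneg),
    h.integral_eq_one, ENNReal.ofReal_one]

theorem IsSmoothingDensity.isProbabilityMeasure_pi (h : IsSmoothingDensity T v g) :
    IsProbabilityMeasure (densityPi ι v) := by
  have := h.isProbabilityMeasure
  unfold densityPi
  infer_instance

theorem IsSmoothingDensity.measureReal_eq (h : IsSmoothingDensity T v g) {s : Set ℝ}
    (hs : MeasurableSet s) : (densityMeasure v).real s = ∫ y in s, v y := by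
  rw [measureReal_def, densityMeasure, withDensity_apply _ hs,
    ← ofReal_integral_eq_lintegral_ofReal h.integrable.integrableOn
      (Eventually.of_forall h.nonneg), ENNReal.toReal_ofReal]
  exact integral_nonneg h.nonneg

theorem IsSmoothingDensity.integrable_cf (h : IsSmoothingDensity T v g) : Integrable g :=
  h.continuous_cf.integrable_of_hasCompactSupport
    (HasCompactSupport.intro (K := Icc (-T) T) isCompact_Icc fun t ht =>
      h.cf_eq_zero t (by by_contra h'; exact ht (abs_le.1 (not_lt.1 h'))))

/-- The characteristic function of a measure on `ι → ℝ`. -/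
def charFunPi (ρ : Measure (ι → ℝ)) (t : ι → ℝ) : ℂ :=
  ∫ x, exp (((∑ l, t l * x l : ℝ) : ℂ) * I) ∂ρ

/-- The Fourier transform of the indicator function of `(w, z]`, times the characteristic function
`g` and the normalizing constant. -/
def intervalKernel (g : ℝ → ℂ) (w z t : ℝ) : ℂ :=
  1 / (2 * Real.pi) * g t * ∫ y in w..z, exp (-(t * y * I))

theorem IsSmoothingDensity.integrable_intervalKernel (h : IsSmoothingDensity T v g) (w z : ℝ) :
    Integrable (intervalKernel g w z) := by
  have hc : Continuous (intervalKernel g w z) := by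
    unfold intervalKernel
    refine (continuous_const.mul h.continuous_cf).mul ?_
    refine intervalIntegral.continuous_parametric_intervalIntegral_of_continuous' ?_ _ _
    fun_prop
  refine hc.integrable_of_hasCompactSupport
    (HasCompactSupport.intro (K := Icc (-T) T) isCompact_Icc fun t ht => ?_)
  rw [intervalKernel, h.cf_eq_zero t (by by_contra h'; exact ht (abs_le.1 (not_lt.1 h')))]
  simp

theorem intervalKernel_eq {t : ℝ} (ht : t ≠ 0) (w z : ℝ) :
    intervalKernel g w z t = 1 / (2 * Real.pi) * g t *
      ((exp (-(t * w * I)) - exp (-(t * z * I))) / (t * I)) := by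
  have hc : (-(t * I) : ℂ) ≠ 0 := by simp [ht]
  have h1 : ∫ y in w..z, exp (-(t * y * I)) = ∫ y in w..z, exp (-(t * I) * (y : ℂ)) := by
    congr 1; ext y; congr 1; ring
  rw [intervalKernel, h1, integral_exp_mul_complex hc]
  congr 1
  have hc' : (t * I : ℂ) ≠ 0 := by simp [ht]
  rw [show -(t * I) * (z : ℂ) = -(t * z * I) by ring, show -(t * I) * (w : ℂ) = -(t * w * I) by ring]
  field_simp
  ring

/-- Integrate the inversion formula for `v` over the interval and exchange the integrals; the shift
by `x` comes out as a phase, ready to be integrated against a law of `x`. -/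
theorem IsSmoothingDensity.measureReal_Ioc (h : IsSmoothingDensity T v g) {w z : ℝ} (hwz : w ≤ z)
    (x : ℝ) : ((densityMeasure v).real (Ioc (w - x) (z - x)) : ℂ) =
      ∫ t, intervalKernel g w z t * exp (t * x * I) := by
  rw [h.measureReal_eq measurableSet_Ioc, ← intervalIntegral.integral_of_le (by linarith),
    ← intervalIntegral.integral_comp_sub_right (fun y => v y) x, ← intervalIntegral.integral_ofReal]
  simp only [h.eq_integral]
  rw [intervalIntegral.integral_const_mul, MeasureTheory.intervalIntegral_integral_swap]
  · rw [← integral_const_mul]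
    congr 1; ext t
    rw [intervalKernel, mul_assoc, mul_assoc, mul_assoc]
    congr 1
    rw [← intervalIntegral.integral_mul_const, ← intervalIntegral.integral_const_mul]
    congr 1; ext y
    rw [← Complex.exp_add]
    congr 2; push_cast; ring
  · have : IsFiniteMeasure (volume.restrict (uIoc w z)) := ⟨by simp [uIoc]⟩
    refine (h.integrable_cf.comp_snd (volume.restrict (uIoc w z))).mul_bdd (c := 1) ?_ ?_
    · exact Continuous.aestronglyMeasurable (by fun_prop)
    · refine Eventually.of_forall fun p => ?_
      have := Complex.norm_exp_ofReal_mul_I (-(p.2 * (p.1 - x)))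
      push_cast at this ⊢
      rw [← this]
      refine le_of_eq ?_
      congr 2; ring

theorem conv_real_apply {G : Type*} [AddMonoid G] [MeasurableSpace G] [MeasurableAdd₂ G]
    (ρ V : Measure G) [IsProbabilityMeasure ρ] [IsProbabilityMeasure V] {s : Set G}
    (hs : MeasurableSet s) :
    (ρ ∗ V).real s = ∫ x, V.real {y | x + y ∈ s} ∂ρ := by
  have hm : Measurable fun x => V {y | x + y ∈ s} :=
    measurable_measure_prodMk_left (s := {p : G × G | p.1 + p.2 ∈ s})
      (measurable_add hs)
  have h1 : (ρ ∗ V) s = ∫⁻ x, V {y | x + y ∈ s} ∂ρ := by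
    rw [Measure.conv, Measure.map_apply measurable_add hs, Measure.prod_apply (measurable_add hs)]
    rfl
  rw [measureReal_def, h1, ← integral_toReal hm.aemeasurable
    (Eventually.of_forall fun x => measure_lt_top _ _)]
  rfl

theorem exp_sum_mul_I (t x : ι → ℝ) :
    exp (((∑ l, t l * x l : ℝ) : ℂ) * I) = ∏ l, exp (t l * x l * I) := by
  rw [← Complex.exp_sum]
  push_cast
  rw [Finset.sum_mul]

theorem IsSmoothingDensity.conv_measureReal_pi_Ioc (h : IsSmoothingDensity T v g)
    (ρ : Measure (ι → ℝ)) [IsProbabilityMeasure ρ] {w z : ι → ℝ} (hwz : w ≤ z) :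
    ((ρ ∗ densityPi ι v).real (univ.pi fun l => Ioc (w l) (z l)) : ℂ) =
      ∫ t : ι → ℝ, (∏ l, intervalKernel g (w l) (z l) (t l)) * charFunPi ρ t := by
  have := h.isProbabilityMeasure
  have := h.isProbabilityMeasure_pi (ι := ι)
  have hK : Integrable fun t : ι → ℝ => ∏ l, intervalKernel g (w l) (z l) (t l) :=
    Integrable.fintype_prod fun l => h.integrable_intervalKernel (w l) (z l)
  rw [conv_real_apply ρ _ (MeasurableSet.univ_pi fun l => measurableSet_Ioc), ← integral_complex_ofReal]
  have h1 : ∀ x : ι → ℝ,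
      ((densityPi ι v).real {y | x + y ∈ univ.pi fun l => Ioc (w l) (z l)} : ℂ)
      = ∫ t : ι → ℝ, (∏ l, intervalKernel g (w l) (z l) (t l)) *
          exp (((∑ l, t l * x l : ℝ) : ℂ) * I) := by
    intro x
    have hset : {y | x + y ∈ univ.pi fun l => Ioc (w l) (z l)}
        = univ.pi fun l => Ioc (w l - x l) (z l - x l) := by
      ext y
      simp only [mem_ofPred_eq, mem_univ_pi, Pi.add_apply, mem_Ioc]
      refine forall_congr' fun l => ?_
      constructor <;> rintro ⟨h1, h2⟩ <;> constructor <;> linarith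
    rw [hset, measureReal_def, densityPi, Measure.pi_pi, ENNReal.toReal_prod, ofReal_prod]
    simp only [exp_sum_mul_I, ← Finset.prod_mul_distrib]
    rw [integral_fintype_prod_volume_eq_prod
      (fun l s => intervalKernel g (w l) (z l) s * exp (s * x l * I))]
    exact Finset.prod_congr rfl fun l _ => h.measureReal_Ioc (hwz l) (x l)
  simp only [h1]
  rw [integral_integral_swap]
  · simp only [integral_const_mul]
    rfl
  · refine (hK.comp_snd ρ).mul_bdd (c := 1) ?_ ?_
    · exact Continuous.aestronglyMeasurable (by fun_prop)
    · exact Eventually.of_forall fun p => (Complex.norm_exp_ofReal_mul_I _).le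

theorem tendsto_measureReal_pi_Ioc (ρ : Measure (ι → ℝ)) [IsProbabilityMeasure ρ] (z : ι → ℝ) :
    Tendsto (fun n : ℕ => ρ.real (univ.pi fun l => Ioc (-(n : ℝ)) (z l))) atTop
      (𝓝 (ρ.real (Iic z))) := by
  have hmono : Monotone fun n : ℕ => (univ.pi fun l => Ioc (-(n : ℝ)) (z l)) := by
    intro a b hab
    refine pi_mono fun l _ => Ioc_subset_Ioc_left ?_
    have : (a : ℝ) ≤ b := by exact_mod_cast hab
    linarith
  have hU : ⋃ n : ℕ, (univ.pi fun l => Ioc (-(n : ℝ)) (z l)) = Iic z := by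
    ext x
    simp only [mem_iUnion, mem_univ_pi, mem_Ioc, mem_Iic]
    constructor
    · rintro ⟨n, hn⟩ l
      exact (hn l).2
    · intro hx
      obtain ⟨n, hn⟩ := exists_nat_gt ‖x‖
      refine ⟨n, fun l => ⟨?_, hx l⟩⟩
      have h1 := norm_le_pi_norm x l
      have h2 := neg_abs_le (x l)
      rw [Real.norm_eq_abs] at h1
      linarith
  rw [← hU]
  exact (ENNReal.tendsto_toReal (measure_ne_top _ _)).comp (tendsto_measure_iUnion_atTop hmono)

/-- Riemann-Lebesgue along the direction of the indicator function of a nonempty set. -/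
theorem tendsto_integral_exp_sum (q : (ι → ℝ) → ℂ) {S : Finset ι} (hS : S.Nonempty) :
    Tendsto (fun n : ℕ => ∫ t : ι → ℝ, exp (((n * ∑ l ∈ S, t l : ℝ) : ℂ) * I) * q t) atTop
      (𝓝 0) := by
  classical
  -- Since `S` is nonempty this functional is nonzero, so its multiples `-n/(2π)` leave every
  -- compact set of the dual, as the general Riemann-Lebesgue lemma requires.
  let w0 : StrongDual ℝ (ι → ℝ) := ∑ l ∈ S, ContinuousLinearMap.proj (R := ℝ) (φ := fun _ : ι => ℝ) l
  have hw0 : w0 ≠ 0 := by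
    intro h
    obtain ⟨l, hl⟩ := hS
    have := congrArg (fun f : StrongDual ℝ (ι → ℝ) => f (Pi.single l 1)) h
    simp [w0, Pi.single_apply, hl] at this
  have hR := tendsto_integral_exp_smul_cocompact q (volume : Measure (ι → ℝ))
  have hw : Tendsto (fun n : ℕ => (-((n : ℝ) / (2 * Real.pi))) • w0) atTop
      (cocompact (StrongDual ℝ (ι → ℝ))) := by
    rw [← Metric.cobounded_eq_cocompact, ← tendsto_norm_atTop_iff_cobounded]
    have hp : 0 < ‖w0‖ / (2 * Real.pi) := div_pos (norm_pos_iff.2 hw0) (by positivity)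
    refine (tendsto_natCast_atTop_atTop.atTop_mul_const hp).congr fun n => ?_
    rw [norm_smul, norm_neg, Real.norm_of_nonneg (by positivity)]
    ring
  refine (hR.comp hw).congr fun n => ?_
  simp only [Function.comp]
  congr 1; ext t
  rw [Circle.smul_def, Real.fourierChar_apply, smul_eq_mul]
  congr 4
  simp only [w0, smul_apply, sum_apply,
    ContinuousLinearMap.proj_apply, smul_eq_mul]
  field_simp

theorem measure_coord_eq_zero (l : ι) : ∀ᵐ t : ι → ℝ, t l ≠ 0 := by
  rw [volume_pi, ae_iff]
  simpa using Measure.pi_hyperplane (fun _ : ι => (volume : Measure ℝ)) l 0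

theorem ae_forall_ne_zero : ∀ᵐ t : ι → ℝ, ∀ l, t l ≠ 0 := ae_all_iff.2 measure_coord_eq_zero

theorem norm_charFunPi_le (ρ : Measure (ι → ℝ)) [IsProbabilityMeasure ρ] (t : ι → ℝ) :
    ‖charFunPi ρ t‖ ≤ 1 := by
  refine (norm_integral_le_of_norm_le_const (C := 1)
    (Eventually.of_forall fun x => (Complex.norm_exp_ofReal_mul_I _).le)).trans_eq ?_
  simp

theorem continuous_charFunPi (ρ : Measure (ι → ℝ)) [IsProbabilityMeasure ρ] :
    Continuous (charFunPi ρ) := by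
  refine continuous_of_dominated (bound := fun _ => 1) (fun t => ?_) (fun t => ?_)
    (integrable_const 1) ?_
  · exact Continuous.aestronglyMeasurable (by fun_prop)
  · exact Eventually.of_forall fun x => (Complex.norm_exp_ofReal_mul_I _).le
  · exact Eventually.of_forall fun x => by fun_prop

/-- Inversion formula, as a bound: a linear combination of smoothed distribution functions is
controlled by its characteristic function. -/
theorem IsSmoothingDensity.norm_sum_conv_le (h : IsSmoothingDensity T v g) {β : Type*}
    (s : Finset β) (c : β → ℂ) (ρ : β → Measure (ι → ℝ)) [∀ b, IsProbabilityMeasure (ρ b)]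
    (f : (ι → ℝ) → ℂ) (hf : ∀ t, f t = ∑ b ∈ s, c b * charFunPi (ρ b) t)
    (hint : IntegrableOn (fun t : ι → ℝ => f t / ((∏ l, t l : ℝ) : ℂ)) {t | ‖t‖ ≤ T}) (z : ι → ℝ) :
    ‖∑ b ∈ s, c b * ((ρ b ∗ densityPi ι v).real (Iic z) : ℂ)‖ ≤
      1 / (2 * Real.pi) ^ Fintype.card ι *
        ∫ t : ι → ℝ in {t | ‖t‖ ≤ T}, ‖f t / ((∏ l, t l : ℝ) : ℂ)‖ := by
  classical
  have := h.isProbabilityMeasure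
  have := h.isProbabilityMeasure_pi (ι := ι)
  set B : Set (ι → ℝ) := {t | ‖t‖ ≤ T} with hB
  have hBm : MeasurableSet B := measurableSet_le measurable_norm measurable_const
  set F : (ι → ℝ) → ℂ := fun t => f t / ((∏ l, t l : ℝ) : ℂ) with hF
  set N := Fintype.card ι
  -- The part of the kernels independent of the box. It vanishes off the cube of radius `T` and
  -- supplies the constant `1/(2π)^m`.
  set γ : (ι → ℝ) → ℂ := fun t => ∏ l, (1 / (2 * Real.pi) * g (t l) / I) with hγ
  have hγn : ∀ t, ‖γ t‖ ≤ 1 / (2 * Real.pi) ^ N := by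
    intro t
    rw [hγ]
    simp only [norm_prod, norm_div, norm_mul, norm_I, div_one]
    refine (Finset.prod_le_prod (fun _ _ => by positivity)
      (g := fun _ => 1 / (2 * Real.pi)) fun l _ => ?_).trans_eq ?_
    · rw [show ‖(1 : ℂ)‖ / (‖(2 : ℂ)‖ * ‖(Real.pi : ℂ)‖) = 1 / (2 * Real.pi) by
        simp [abs_of_pos Real.pi_pos]]
      exact mul_le_of_le_one_right (by positivity) (h.norm_cf_le _)
    · rw [Finset.prod_const, Finset.card_univ, div_pow, one_pow]
  have hγ0 : ∀ t, t ∉ B → γ t = 0 := by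
    intro t ht
    have : ∃ l, T < |t l| := by
      by_contra h'
      push Not at h'
      refine ht ?_
      rcases isEmpty_or_nonempty ι with hι | ⟨⟨l⟩⟩
      -- Without coordinates the claim could fail only for `T < 0`; then `g`, hence `v`, would
      -- vanish, against total mass one.
      · rw [hB, mem_ofPred_eq, Subsingleton.elim t 0, norm_zero]
        by_contra hT
        have hT' : ∀ t, g t = 0 := fun t => h.cf_eq_zero t ((not_le.1 hT).trans_le (abs_nonneg t))
        have h1 : ∀ y, v y = 0 := fun y => by
          have := h.eq_integral y
          simp only [hT', zero_mul, integral_zero, mul_zero] at this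
          exact_mod_cast this
        have h2 := h.integral_eq_one
        simp [h1] at h2
      · exact (pi_norm_le_iff_of_nonneg ((abs_nonneg _).trans (h' l))).2 h'
    obtain ⟨l, hl⟩ := this
    refine Finset.prod_eq_zero (Finset.mem_univ l) ?_
    rw [h.cf_eq_zero _ hl]; simp
  have hγc : Continuous γ := continuous_finsetProd _ fun l _ =>
    (continuous_const.mul (h.continuous_cf.comp (continuous_apply l))).div_const _
  set q : (ι → ℝ) → ℂ := fun t => γ t * B.indicator F t with hq
  have hFi : Integrable (B.indicator F) := hint.integrable_indicator hBm
  have hqi : Integrable q := hFi.bdd_mul hγc.aestronglyMeasurable (Eventually.of_forall hγn)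
  -- Each kernel is a difference of exponentials, one at the lower endpoint `-n` and one at `z l`.
  -- Expanding the product, `S` is the set of coordinates where the lower endpoint is chosen.
  set qS : Finset ι → (ι → ℝ) → ℂ := fun S t =>
    (∏ l ∈ Finset.univ \ S, -exp (-(t l * z l * I))) * q t with hqS
  have hnorm1 : ∀ S : Finset ι, ∀ t : ι → ℝ,
      ‖∏ l ∈ Finset.univ \ S, -exp (-(t l * z l * I))‖ = 1 := by
    intro S t
    rw [norm_prod]
    refine Finset.prod_eq_one fun l _ => ?_
    have := Complex.norm_exp_ofReal_mul_I (-(t l * z l))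
    push_cast at this
    rw [norm_neg, ← this]
    congr 2; ring
  have hqSi : ∀ S, Integrable (qS S) := fun S => hqi.bdd_mul
    (Continuous.aestronglyMeasurable (by fun_prop)) (Eventually.of_forall fun t => (hnorm1 S t).le)
  have hexp : ∀ n : ℕ, ∀ S : Finset ι, ∀ t : ι → ℝ,
      ∏ l ∈ S, exp (t l * n * I) = exp (((n * ∑ l ∈ S, t l : ℝ) : ℂ) * I) := by
    intro n S t
    rw [← Complex.exp_sum]
    congr 1
    push_cast
    rw [Finset.mul_sum, Finset.sum_mul]
    exact Finset.sum_congr rfl fun l _ => by ring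
  have hbox : ∀ n : ℕ, ‖z‖ ≤ n →
      ∑ b ∈ s, c b * ((ρ b ∗ densityPi ι v).real (univ.pi fun l => Ioc (-(n : ℝ)) (z l)) : ℂ)
      = ∑ S ∈ (Finset.univ : Finset ι).powerset,
        ∫ t : ι → ℝ, exp (((n * ∑ l ∈ S, t l : ℝ) : ℂ) * I) * qS S t := by
    intro n hn
    have hwz : (fun _ : ι => -(n : ℝ)) ≤ z := by
      intro l
      have h1 := norm_le_pi_norm z l
      have h2 := neg_abs_le (z l)
      rw [Real.norm_eq_abs] at h1
      simp only
      linarith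
    have hK : Integrable fun t : ι → ℝ => ∏ l, intervalKernel g (-(n : ℝ)) (z l) (t l) :=
      Integrable.fintype_prod fun l => h.integrable_intervalKernel (-(n : ℝ)) (z l)
    have hsum : ∑ b ∈ s, c b *
        ((ρ b ∗ densityPi ι v).real (univ.pi fun l => Ioc (-(n : ℝ)) (z l)) : ℂ)
        = ∫ t : ι → ℝ, (∏ l, intervalKernel g (-(n : ℝ)) (z l) (t l)) * f t := by
      simp only [hf, Finset.mul_sum]
      rw [integral_finsetSum]
      · refine Finset.sum_congr rfl fun b _ => ?_
        rw [h.conv_measureReal_pi_Ioc (ρ b) hwz, ← integral_const_mul]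
        congr 1; ext t; ring
      · intro b _
        have := (hK.mul_bdd (continuous_charFunPi (ρ b)).aestronglyMeasurable
          (Eventually.of_forall (norm_charFunPi_le (ρ b)))).const_mul (c b)
        refine this.congr (Eventually.of_forall fun t => ?_)
        simp only; ring
    rw [hsum, ← integral_finsetSum]
    · refine integral_congr_ae ?_
      filter_upwards [ae_forall_ne_zero (ι := ι)] with t ht
      have hprod : (∏ l, intervalKernel g (-(n : ℝ)) (z l) (t l)) * f t
          = (∏ l, (exp (t l * n * I) + -exp (-(t l * z l * I)))) * (γ t * F t) := by
        have hF' : F t = f t * ∏ l, ((t l : ℂ))⁻¹ := by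
          rw [hF]; simp only; push_cast; rw [div_eq_mul_inv, Finset.prod_inv_distrib]
        rw [hF', hγ]
        simp only
        rw [mul_left_comm _ (f t), mul_left_comm _ (f t), ← Finset.prod_mul_distrib,
          ← Finset.prod_mul_distrib, mul_comm]
        congr 1
        refine Finset.prod_congr rfl fun l _ => ?_
        rw [intervalKernel_eq (ht l)]
        have : (t l : ℂ) ≠ 0 := by exact_mod_cast ht l
        push_cast
        rw [show -(↑(t l) * -(n : ℂ) * I) = t l * n * I by ring]
        field_simp
        ring
      have hind : γ t * F t = q t := by
        rw [hq]
        by_cases hmem : t ∈ B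
        · simp [hmem]
        · simp [hγ0 t hmem]
      rw [hprod, hind, Finset.prod_add, Finset.sum_mul]
      refine Finset.sum_congr rfl fun S _ => ?_
      rw [hexp, hqS]
      simp only
      ring
    · intro S _
      exact (hqSi S).bdd_mul (c := 1) (Continuous.aestronglyMeasurable (by fun_prop))
        (Eventually.of_forall fun t => (Complex.norm_exp_ofReal_mul_I _).le)
  have hlim1 : Tendsto (fun n : ℕ => ∑ b ∈ s, c b *
      ((ρ b ∗ densityPi ι v).real (univ.pi fun l => Ioc (-(n : ℝ)) (z l)) : ℂ)) atTop
      (𝓝 (∑ b ∈ s, c b * ((ρ b ∗ densityPi ι v).real (Iic z) : ℂ))) :=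
    tendsto_finsetSum _ fun b _ => ((continuous_ofReal.tendsto _).comp
      (tendsto_measureReal_pi_Ioc (ρ b ∗ densityPi ι v) z)).const_mul (c b)
  -- Every term using a lower endpoint oscillates with frequency `n` and dies; only `S = ∅`
  -- survives.
  have hlim2 : Tendsto (fun n : ℕ => ∑ S ∈ (Finset.univ : Finset ι).powerset,
        ∫ t : ι → ℝ, exp (((n * ∑ l ∈ S, t l : ℝ) : ℂ) * I) * qS S t) atTop
      (𝓝 (∑ S ∈ (Finset.univ : Finset ι).powerset, if S = ∅ then ∫ t, qS ∅ t else 0)) := by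
    refine tendsto_finsetSum _ fun S _ => ?_
    split_ifs with hS
    · subst hS
      simp
    · exact tendsto_integral_exp_sum (qS S) (Finset.nonempty_iff_ne_empty.2 hS)
  obtain ⟨n0, hn0⟩ := exists_nat_ge ‖z‖
  have hlim3 := hlim1.congr' ((eventually_ge_atTop n0).mono fun n hn =>
    hbox n (hn0.trans (by exact_mod_cast hn)))
  rw [tendsto_nhds_unique hlim3 hlim2, Finset.sum_ite_eq' _ _ (fun _ => ∫ t, qS ∅ t),
    if_pos (Finset.empty_mem_powerset _), ← integral_indicator hBm, ← integral_const_mul]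
  refine norm_integral_le_of_norm_le ?_ (Eventually.of_forall fun t => ?_)
  · exact ((integrable_indicator_iff hBm).2 hint.norm).const_mul _
  · rw [hqS, hq]
    simp only
    rw [norm_mul, hnorm1, one_mul, norm_mul]
    by_cases hmem : t ∈ B
    · simp only [indicator_of_mem hmem]
      gcongr
      exact hγn t
    · simp [indicator_of_notMem hmem]

end Inversion


/-! ### Removing the smoothing. -/

section Smoothing

open Set Filter Topology

variable {ι : Type*} [Fintype ι] {T : ℝ} {v : ℝ → ℝ} {g : ℝ → ℂ}

theorem conv_measureReal_Iic (ρ V : Measure (ι → ℝ)) [IsProbabilityMeasure ρ]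
    [IsProbabilityMeasure V] (c : ι → ℝ) :
    (ρ ∗ V).real (Iic c) = ∫ x, ρ.real (Iic (c - x)) ∂V := by
  rw [Measure.conv_comm, conv_real_apply V ρ measurableSet_Iic]
  congr 1; ext x; congr 1; ext y
  simp only [mem_ofPred_eq, mem_Iic, le_sub_iff_add_le']

theorem integrable_measureReal_Iic_sub (ρ V : Measure (ι → ℝ)) [IsProbabilityMeasure ρ]
    [IsProbabilityMeasure V] (c : ι → ℝ) : Integrable (fun x => ρ.real (Iic (c - x))) V := by
  have hm : Measurable fun x => ρ {y | y ∈ Iic (c - x)} :=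
    measurable_measure_prodMk_left (s := {p : (ι → ℝ) × (ι → ℝ) | p.2 ≤ c - p.1})
      (measurableSet_le measurable_snd (measurable_const.sub measurable_fst))
  refine (integrable_const (1 : ℝ)).mono' (hm.ennreal_toReal.aestronglyMeasurable) ?_
  exact Eventually.of_forall fun x => by
    rw [Real.norm_of_nonneg measureReal_nonneg]; exact measureReal_le_one

theorem IsSmoothingDensity.isNegInvariant (h : IsSmoothingDensity T v g) :
    (densityMeasure v).IsNegInvariant := by
  constructor
  ext s hs
  have hm : Measurable fun y => ENNReal.ofReal (v y) := h.continuous.measurable.ennreal_ofReal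
  rw [Measure.neg, Measure.map_apply measurable_neg hs, densityMeasure, withDensity_apply _ hs,
    withDensity_apply _ (measurable_neg hs),
    ← (Measure.measurePreserving_neg (volume : Measure ℝ)).setLIntegral_comp_preimage hs hm]
  simp only [h.symm]

theorem IsSmoothingDensity.one_sub_le (h : IsSmoothingDensity T v g) {r : ℝ} (hr : 0 < r) :
    1 - 64 / (Real.pi * (T * r) ^ 3) ≤ (densityMeasure v).real (Icc (-r) r) := by
  have := h.isProbabilityMeasure
  have hc : (Icc (-r) r)ᶜ = {y : ℝ | r < |y|} := by
    ext y
    rw [mem_compl_iff, mem_Icc, ← abs_le, not_le, mem_ofPred_eq]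
  have h1 := probReal_compl_eq_one_sub (μ := densityMeasure v) (measurableSet_Icc (a := -r) (b := r))
  rw [hc, h.measureReal_eq (measurableSet_lt measurable_const (by fun_prop))] at h1
  linarith [h.tail_le r hr]

/-- The maximum-norm cube of radius `r`. -/
def cube (ι : Type*) (r : ℝ) : Set (ι → ℝ) := univ.pi fun _ => Icc (-r) r

theorem measurableSet_cube (r : ℝ) : MeasurableSet (cube ι r) :=
  MeasurableSet.univ_pi fun _ => measurableSet_Icc

theorem IsSmoothingDensity.measureReal_cube (h : IsSmoothingDensity T v g) (r : ℝ) :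
    (densityPi ι v).real (cube ι r) = (densityMeasure v).real (Icc (-r) r) ^ Fintype.card ι := by
  have := h.isProbabilityMeasure
  rw [measureReal_def, densityPi, cube, Measure.pi_pi, Finset.prod_const, ENNReal.toReal_pow]
  rfl

/-- Both the law and the cube are invariant under negation. Linear terms hence average out, and the
smoothing costs `r` rather than `2r` in each coordinate. -/
theorem IsSmoothingDensity.setIntegral_cube_coord (h : IsSmoothingDensity T v g) (r : ℝ) (l : ι) :
    ∫ x in cube ι r, x l ∂(densityPi ι v) = 0 := by
  have := h.isProbabilityMeasure
  have := h.isNegInvariant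
  have hV : (densityPi ι v).IsNegInvariant := by unfold densityPi; infer_instance
  rw [← integral_indicator (measurableSet_cube r)]
  have h1 := integral_neg_eq_self ((cube ι r).indicator fun x : ι → ℝ => x l) (densityPi ι v)
  have h2 : ∀ x : ι → ℝ, (cube ι r).indicator (fun x : ι → ℝ => x l) (-x)
      = -(cube ι r).indicator (fun x : ι → ℝ => x l) x := by
    intro x
    have : -x ∈ cube ι r ↔ x ∈ cube ι r := by
      simp only [cube, mem_univ_pi, Pi.neg_apply, mem_Icc]
      refine forall_congr' fun k => ?_
      constructor <;> rintro ⟨h1, h2⟩ <;> constructor <;> linarith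
    by_cases hx : x ∈ cube ι r
    · rw [indicator_of_mem hx, indicator_of_mem (this.2 hx), Pi.neg_apply]
    · rw [indicator_of_notMem hx, indicator_of_notMem (fun h => hx (this.1 h)), neg_zero]
  simp only [h2, integral_neg] at h1
  linarith

theorem integrableOn_cube_coord (V : Measure (ι → ℝ)) [IsProbabilityMeasure V] (r : ℝ) (l : ι) :
    IntegrableOn (fun x : ι → ℝ => x l) (cube ι r) V := by
  refine Integrable.mono' (integrable_const r) (measurable_pi_apply l).aestronglyMeasurable ?_
  refine (ae_restrict_mem (measurableSet_cube r)).mono fun x hx => ?_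
  have := hx l (mem_univ l)
  rw [Real.norm_eq_abs]
  exact abs_le.2 this

/-- A function bounded below by an affine function on a cube and by `-δ` outside of it has a large
integral. -/
theorem IsSmoothingDensity.le_integral (h : IsSmoothingDensity T v g) {r D δ : ℝ} (a : ι → ℝ)
    (Φ : (ι → ℝ) → ℝ) (hΦ : Integrable Φ (densityPi ι v)) (hδ : ∀ x, -δ ≤ Φ x)
    (hD : ∀ x ∈ cube ι r, D + ∑ l, a l * x l ≤ Φ x) :
    (densityPi ι v).real (cube ι r) * D - (1 - (densityPi ι v).real (cube ι r)) * δ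
      ≤ ∫ x, Φ x ∂(densityPi ι v) := by
  have := h.isProbabilityMeasure_pi (ι := ι)
  have hQ := measurableSet_cube (ι := ι) r
  rw [← integral_add_compl hQ hΦ]
  have hl : ∀ l, IntegrableOn (fun x : ι → ℝ => a l * x l) (cube ι r) (densityPi ι v) := fun l =>
    (integrableOn_cube_coord _ r l).const_mul _
  have h1 : (densityPi ι v).real (cube ι r) * D ≤ ∫ x in cube ι r, Φ x ∂(densityPi ι v) := by
    have : ∫ x in cube ι r, (D + ∑ l, a l * x l) ∂(densityPi ι v)
        = (densityPi ι v).real (cube ι r) * D := by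
      rw [integral_add (integrable_const D) (integrable_finsetSum _ fun l _ => hl l),
        integral_finsetSum _ fun l _ => hl l]
      simp [integral_const_mul, h.setIntegral_cube_coord]
    rw [← this]
    exact setIntegral_mono_on ((integrable_const D).add (integrable_finsetSum _ fun l _ => hl l))
      hΦ.integrableOn hQ hD
  have h2 : -((1 - (densityPi ι v).real (cube ι r)) * δ)
      ≤ ∫ x in (cube ι r)ᶜ, Φ x ∂(densityPi ι v) := by
    have : ∫ x in (cube ι r)ᶜ, -δ ∂(densityPi ι v)
        = -((1 - (densityPi ι v).real (cube ι r)) * δ) := by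
      rw [setIntegral_const, probReal_compl_eq_one_sub hQ, smul_eq_mul, mul_neg]
    rw [← this]
    exact setIntegral_mono_on (integrable_const _) hΦ.integrableOn hQ.compl fun x _ => hδ x
  linarith

/-- Smoothing inequality: the uniform distance of two distribution functions, one of which has
one-sided Lipschitz bounds, is controlled by the uniform distance after smoothing. -/
theorem IsSmoothingDensity.abs_sub_le (h : IsSmoothingDensity T v g) (μ ν : Measure (ι → ℝ))
    [IsProbabilityMeasure μ] [IsProbabilityMeasure ν] (a : ι → ℝ) (ha : ∀ l, 0 ≤ a l)
    (hν : ∀ z z' : ι → ℝ, z ≤ z' →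
      ν.real (Iic z') - ν.real (Iic z) ≤ ∑ l, a l * (z' l - z l))
    {r S : ℝ} (hr : 0 ≤ r) (hp : 3 / 4 ≤ (densityPi ι v).real (cube ι r))
    (hS : ∀ z, |(μ ∗ densityPi ι v).real (Iic z) - (ν ∗ densityPi ι v).real (Iic z)| ≤ S)
    (z : ι → ℝ) :
    |μ.real (Iic z) - ν.real (Iic z)| ≤ 2 * S + 3 / 2 * r * ∑ l, a l := by
  have := h.isProbabilityMeasure_pi (ι := ι)
  set V := densityPi ι v
  set p := V.real (cube ι r)
  have hp1 : p ≤ 1 := measureReal_le_one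
  set Δ : (ι → ℝ) → ℝ := fun z => μ.real (Iic z) - ν.real (Iic z) with hΔ
  set A := ∑ l, a l with hA
  have hA0 : 0 ≤ A := Finset.sum_nonneg fun l _ => ha l
  have hS0 : 0 ≤ S := (abs_nonneg _).trans (hS 0)
  have hint : ∀ c, Integrable (fun x => Δ (c - x)) V := fun c =>
    (integrable_measureReal_Iic_sub μ V c).sub (integrable_measureReal_Iic_sub ν V c)
  have hconv : ∀ c, |∫ x, Δ (c - x) ∂V| ≤ S := by
    intro c
    have := hS c
    rwa [conv_measureReal_Iic, conv_measureReal_Iic, ← integral_sub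
      (integrable_measureReal_Iic_sub μ V c) (integrable_measureReal_Iic_sub ν V c)] at this
  have hbdd : BddAbove (range fun z => |Δ z|) := by
    refine ⟨1, ?_⟩
    rintro _ ⟨z, rfl⟩
    have h1 : μ.real (Iic z) ≤ 1 := measureReal_le_one
    have h2 : ν.real (Iic z) ≤ 1 := measureReal_le_one
    have h3 : 0 ≤ μ.real (Iic z) := measureReal_nonneg
    have h4 : 0 ≤ ν.real (Iic z) := measureReal_nonneg
    simp only [hΔ]
    rw [abs_le]
    constructor <;> linarith
  set δ := ⨆ z, |Δ z|
  have hδ : ∀ z, |Δ z| ≤ δ := fun z => le_ciSup hbdd z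
  have hmonoμ : ∀ {z z' : ι → ℝ}, z ≤ z' → μ.real (Iic z) ≤ μ.real (Iic z') := fun h =>
    measureReal_mono (Iic_subset_Iic.2 h)
  have key : ∀ z, p * |Δ z| ≤ S + p * (r * A) + (1 - p) * δ := by
    intro z
    have hsum : ∀ (x : ι → ℝ), ∑ l, a l * (r - x l) = r * A + -∑ l, a l * x l := by
      intro x
      rw [hA, Finset.mul_sum, ← Finset.sum_neg_distrib, ← Finset.sum_add_distrib]
      exact Finset.sum_congr rfl fun l _ => by ring
    -- Smooth at the shifted point `z + r`: for `x` in the cube, `z + r - x` dominates `z`, so `μ`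
    -- only helps and `ν` loses at most the Lipschitz amount. Outside the cube the trivial bound
    -- `-δ` is used. The lower bound shifts by `-r`.
    have hup : p * Δ z ≤ S + p * (r * A) + (1 - p) * δ := by
      have h1 := h.le_integral (r := r) (D := Δ z - r * A) (δ := δ) a
        (fun x => Δ (z + (fun _ => r) - x)) (hint _) (fun x => (abs_le.1 (hδ _)).1) (by
          intro x hx
          have hle : z ≤ z + (fun _ => r) - x := by
            intro l
            have := (hx l (mem_univ l)).2
            simp only [Pi.sub_apply, Pi.add_apply]
            linarith
          have h2 := hν _ _ hle
          have h3 := hmonoμ hle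
          have h4 : ∑ l, a l * ((z + (fun _ => r) - x : ι → ℝ) l - z l) = r * A + -∑ l, a l * x l := by
            rw [← hsum]
            exact Finset.sum_congr rfl fun l _ => by
              simp only [Pi.sub_apply, Pi.add_apply]; ring
          rw [h4] at h2
          simp only [hΔ]
          linarith)
      have h2 := (abs_le.1 (hconv (z + (fun _ => r)))).2
      have h3 : p * (Δ z - r * A) - (1 - p) * δ ≤ S := h1.trans h2
      linarith
    have hlow : p * (-Δ z) ≤ S + p * (r * A) + (1 - p) * δ := by
      have h1 := h.le_integral (r := r) (D := -Δ z - r * A) (δ := δ) (-a)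
        (fun x => -Δ (z - (fun _ => r) - x)) (hint _).neg
        (fun x => neg_le_neg (abs_le.1 (hδ _)).2) (by
          intro x hx
          have hle : z - (fun _ => r) - x ≤ z := by
            intro l
            have := (hx l (mem_univ l)).1
            simp only [Pi.sub_apply]
            linarith
          have h2 := hν _ _ hle
          have h3 := hmonoμ hle
          have h4 : ∑ l, a l * (z l - (z - (fun _ => r) - x : ι → ℝ) l) = r * A + ∑ l, a l * x l := by
            rw [hA, Finset.mul_sum, ← Finset.sum_add_distrib]
            exact Finset.sum_congr rfl fun l _ => by
              simp only [Pi.sub_apply]; ring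
          rw [h4] at h2
          simp only [hΔ, Pi.neg_apply, neg_mul, Finset.sum_neg_distrib]
          linarith)
      rw [integral_neg] at h1
      have h2 := (abs_le.1 (hconv (z - (fun _ => r)))).1
      have h3 : p * (-Δ z - r * A) - (1 - p) * δ ≤ S := h1.trans (by linarith)
      linarith
    rcases abs_choice (Δ z) with e | e <;> rw [e] <;> assumption
  have hp0 : 0 < p := by linarith
  have hδ2 : p * δ ≤ S + p * (r * A) + (1 - p) * δ := by
    rw [← le_div_iff₀' hp0]
    exact ciSup_le fun z => (le_div_iff₀' hp0).2 (key z)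
  have hrA : 0 ≤ r * A := mul_nonneg hr hA0
  refine (hδ z).trans ?_
  -- At `p = 3/4` the bound `(2p - 1) δ ≤ S + p r A` gives exactly the constants 2 and 3/2; larger
  -- `p` only improves it.
  have h5 : (2 * p - 1) * δ ≤ (2 * p - 1) * (2 * S + 3 / 2 * r * A) := by
    nlinarith [mul_nonneg hS0 (sub_nonneg.2 hp), mul_nonneg hrA (sub_nonneg.2 hp)]
  exact le_of_mul_le_mul_left h5 (by linarith)

end Smoothing

/-! ### Laws with independent blocks, and `Λ` as a characteristic function. -/

section Blocks

open Set Filter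

variable {ι : Type*} [Fintype ι] [DecidableEq ι]

/-- The distribution function of the marginal with index set `J`. -/
def marginalCdf (ρ : Measure (ι → ℝ)) (J : Finset ι) (z : ι → ℝ) : ℝ :=
  ρ.real {x | ∀ l ∈ J, x l ≤ z l}

theorem part_mem_parts (α : Finpartition (Finset.univ : Finset ι)) (l : ι) :
    α.part l ∈ α.parts := α.part_mem.2 (Finset.mem_univ l)

/-- The law of a random vector whose subvectors indexed by the blocks of `α` are independent and
distributed like those of `ρ`. -/
def blockMeasure (ρ : Measure (ι → ℝ)) (α : Finpartition (Finset.univ : Finset ι)) :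
    Measure (ι → ℝ) :=
  (Measure.pi fun _ : α.parts => ρ).map fun ω l => ω ⟨α.part l, part_mem_parts α l⟩ l

theorem measurable_glue (α : Finpartition (Finset.univ : Finset ι)) :
    Measurable fun (ω : α.parts → ι → ℝ) (l : ι) => ω ⟨α.part l, part_mem_parts α l⟩ l := by
  fun_prop

instance (ρ : Measure (ι → ℝ)) [IsProbabilityMeasure ρ]
    (α : Finpartition (Finset.univ : Finset ι)) : IsProbabilityMeasure (blockMeasure ρ α) :=
  Measure.isProbabilityMeasure_map (measurable_glue α).aemeasurable

theorem blockMeasure_real_Iic (ρ : Measure (ι → ℝ)) [IsProbabilityMeasure ρ]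
    (α : Finpartition (Finset.univ : Finset ι)) (z : ι → ℝ) :
    (blockMeasure ρ α).real (Iic z) = ∏ J ∈ α.parts, marginalCdf ρ J z := by
  rw [measureReal_def, blockMeasure, Measure.map_apply (measurable_glue α) measurableSet_Iic]
  have : (fun (ω : α.parts → ι → ℝ) (l : ι) => ω ⟨α.part l, part_mem_parts α l⟩ l) ⁻¹' Iic z
      = univ.pi fun J : α.parts => {x | ∀ l ∈ J.1, x l ≤ z l} := by
    ext ω
    simp only [mem_preimage, mem_Iic, mem_univ_pi, mem_ofPred_eq]
    constructor
    · rintro h ⟨J, hJ⟩ l hl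
      have := h l
      simp only [α.part_eq_of_mem hJ hl] at this
      exact this
    · intro h l
      exact h ⟨α.part l, part_mem_parts α l⟩ l (by simp)
  rw [this, Measure.pi_pi, ENNReal.toReal_prod]
  exact Finset.prod_coe_sort α.parts fun J => marginalCdf ρ J z

theorem charFunPi_blockMeasure (ρ : Measure (ι → ℝ)) [IsProbabilityMeasure ρ]
    (α : Finpartition (Finset.univ : Finset ι)) (t : ι → ℝ) :
    charFunPi (blockMeasure ρ α) t = ∏ J ∈ α.parts, charFunPi ρ (zeroOutside J t) := by
  rw [charFunPi, blockMeasure, integral_map (measurable_glue α).aemeasurable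
    (Continuous.aestronglyMeasurable (by fun_prop)), ← Finset.prod_coe_sort]
  unfold charFunPi
  rw [← integral_fintype_prod_eq_prod (μ := fun _ : α.parts => ρ) (fun (J : α.parts) (x : ι → ℝ) =>
    Complex.exp (((∑ l, zeroOutside J.1 t l * x l : ℝ) : ℂ) * Complex.I))]
  congr 1; ext ω
  rw [← Complex.exp_sum, ← Finset.sum_mul, ← Complex.ofReal_sum]
  congr 3
  rw [Finset.sum_comm]
  refine Finset.sum_congr rfl fun l _ => ?_
  rw [Finset.sum_eq_single ⟨α.part l, part_mem_parts α l⟩]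
  · simp [zeroOutside]
  · rintro ⟨J, hJ⟩ - hne
    have : l ∉ J := fun hl => hne (by simp [α.part_eq_of_mem hJ hl])
    simp [zeroOutside, this]
  · simp

/-- Independence of blocks turns the nonlinear operator into a linear combination of characteristic
functions of probability measures, to which inversion applies. -/
theorem Lambda_charFunPi (ρ : Measure (ι → ℝ)) [IsProbabilityMeasure ρ] (t : ι → ℝ) :
    Lambda (charFunPi ρ) t = ∑ α, partitionCoeff α * charFunPi (blockMeasure ρ α) t := by
  simp only [charFunPi_blockMeasure]
  rfl

theorem norm_prod_sub_prod_le {𝕜 β : Type*} [NormedField 𝕜] (s : Finset β) (f g : β → 𝕜)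
    (hf : ∀ b ∈ s, ‖f b‖ ≤ 1) (hg : ∀ b ∈ s, ‖g b‖ ≤ 1) :
    ‖∏ b ∈ s, f b - ∏ b ∈ s, g b‖ ≤ ∑ b ∈ s, ‖f b - g b‖ := by
  classical
  induction s using Finset.induction_on with
  | empty => simp
  | insert b s hb ih =>
    rw [Finset.prod_insert hb, Finset.prod_insert hb, Finset.sum_insert hb]
    have h1 := ih (fun c hc => hf c (Finset.mem_insert_of_mem hc))
      (fun c hc => hg c (Finset.mem_insert_of_mem hc))
    have h2 : ‖∏ c ∈ s, f c‖ ≤ 1 := by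
      rw [norm_prod]
      exact Finset.prod_le_one (fun _ _ => norm_nonneg _)
        fun c hc => hf c (Finset.mem_insert_of_mem hc)
    have h3 := hg b (Finset.mem_insert_self b s)
    calc ‖f b * ∏ c ∈ s, f c - g b * ∏ c ∈ s, g c‖
        = ‖(f b - g b) * ∏ c ∈ s, f c + g b * (∏ c ∈ s, f c - ∏ c ∈ s, g c)‖ := by ring_nf
      _ ≤ ‖f b - g b‖ * ‖∏ c ∈ s, f c‖ + ‖g b‖ * ‖∏ c ∈ s, f c - ∏ c ∈ s, g c‖ := by
        rw [← norm_mul, ← norm_mul]; exact norm_add_le _ _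
      _ ≤ ‖f b - g b‖ * 1 + 1 * ‖∏ c ∈ s, f c - ∏ c ∈ s, g c‖ := by gcongr
      _ ≤ _ := by linarith

theorem norm_marginalCdf_le_one {κ : Type*} (ρ : Measure (κ → ℝ)) [IsProbabilityMeasure ρ]
    (J : Finset κ) (z : κ → ℝ) : ‖marginalCdf ρ J z‖ ≤ 1 := by
  rw [marginalCdf, Real.norm_of_nonneg measureReal_nonneg]
  exact measureReal_le_one

/-- Distribution functions of block laws are products of numbers in `[0, 1]`, so differences
telescope; convolution merely averages the resulting uniform bound. -/
theorem abs_conv_blockMeasure_sub_le (μ ν V : Measure (ι → ℝ)) [IsProbabilityMeasure μ]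
    [IsProbabilityMeasure ν] [IsProbabilityMeasure V] (d : Finset ι → ℝ)
    (hd : ∀ J z, |marginalCdf μ J z - marginalCdf ν J z| ≤ d J)
    (α : Finpartition (Finset.univ : Finset ι)) (z : ι → ℝ) :
    |(blockMeasure μ α ∗ V).real (Iic z) - (blockMeasure ν α ∗ V).real (Iic z)|
      ≤ ∑ J ∈ α.parts, d J := by
  rw [conv_measureReal_Iic, conv_measureReal_Iic, ← integral_sub
    (integrable_measureReal_Iic_sub _ V z) (integrable_measureReal_Iic_sub _ V z),
    ← Real.norm_eq_abs]
  refine (norm_integral_le_of_norm_le_const (C := ∑ J ∈ α.parts, d J)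
    (Eventually.of_forall fun x => ?_)).trans_eq (by simp)
  rw [blockMeasure_real_Iic, blockMeasure_real_Iic]
  exact (norm_prod_sub_prod_le _ _ _ (fun J _ => norm_marginalCdf_le_one μ J _)
    (fun J _ => norm_marginalCdf_le_one ν J _)).trans (Finset.sum_le_sum fun J _ => hd J _)

theorem eq_indiscrete_of_univ_mem (hne : (Finset.univ : Finset ι) ≠ ⊥)
    {α : Finpartition (Finset.univ : Finset ι)} (h : Finset.univ ∈ α.parts) :
    α = Finpartition.indiscrete hne := by
  ext1
  rw [Finpartition.indiscrete_parts]
  refine Finset.eq_singleton_iff_unique_mem.2 ⟨h, fun J hJ => ?_⟩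
  obtain ⟨x, hx⟩ := α.nonempty_of_mem_parts hJ
  exact α.eq_of_mem_parts hJ h hx (Finset.mem_univ x)

/-- Without its indiscrete term, the difference of two `Λ`-combinations of smoothed distribution
functions is controlled by the distances of the proper marginals. -/
theorem abs_conv_sub_le (hι : Nonempty ι) (μ ν V : Measure (ι → ℝ)) [IsProbabilityMeasure μ]
    [IsProbabilityMeasure ν] [IsProbabilityMeasure V] (d : Finset ι → ℝ) (hd0 : ∀ J, 0 ≤ d J)
    (hd : ∀ J z, |marginalCdf μ J z - marginalCdf ν J z| ≤ d J) (z : ι → ℝ) :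
    |(μ ∗ V).real (Iic z) - (ν ∗ V).real (Iic z)| ≤
      ‖∑ α : Finpartition (Finset.univ : Finset ι), partitionCoeff α *
        (((blockMeasure μ α ∗ V).real (Iic z) - (blockMeasure ν α ∗ V).real (Iic z) : ℝ) : ℂ)‖
      + ∑ J : Finset ι with J.Nonempty ∧ J ⊂ Finset.univ,
        (fubini (Fintype.card ι - J.card) : ℝ) * d J := by
  have hne : (Finset.univ : Finset ι) ≠ ⊥ := Finset.univ_nonempty.ne_empty
  set α₀ := Finpartition.indiscrete hne with hα₀
  set W : Finpartition (Finset.univ : Finset ι) → ℝ := fun α =>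
    (blockMeasure μ α ∗ V).real (Iic z) - (blockMeasure ν α ∗ V).real (Iic z) with hW
  have hparts : α₀.parts = {Finset.univ} := rfl
  -- The one-block partition has coefficient `(-1)^0 * 0! = 1` and returns the original laws.
  have h0 : partitionCoeff α₀ * (W α₀ : ℂ) =
      (((μ ∗ V).real (Iic z) - (ν ∗ V).real (Iic z) : ℝ) : ℂ) := by
    have e : ∀ (ρ : Measure (ι → ℝ)) [IsProbabilityMeasure ρ],
        (blockMeasure ρ α₀ ∗ V).real (Iic z) = (ρ ∗ V).real (Iic z) := by
      intro ρ _
      rw [conv_measureReal_Iic, conv_measureReal_Iic]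
      congr 1; ext x
      rw [blockMeasure_real_Iic, hparts, Finset.prod_singleton, marginalCdf]
      congr 1; ext y
      simp [Pi.le_def]
    rw [hW]
    simp only [e]
    simp [partitionCoeff, hparts]
  rw [← Finset.add_sum_erase _ _ (Finset.mem_univ α₀), h0]
  set D : ℝ := (μ ∗ V).real (Iic z) - (ν ∗ V).real (Iic z)
  have h1 : ‖∑ α ∈ Finset.univ.erase α₀, partitionCoeff α * (W α : ℂ)‖
      ≤ ∑ J : Finset ι with J.Nonempty ∧ J ⊂ Finset.univ,
        (fubini (Fintype.card ι - J.card) : ℝ) * d J := by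
    calc _ ≤ ∑ α ∈ Finset.univ.erase α₀, ∑ J ∈ α.parts, ((α.parts.card - 1).factorial : ℝ) * d J := by
          refine norm_sum_le_of_le _ fun α _ => ?_
          rw [norm_mul, partitionCoeff_norm, Complex.norm_real, Real.norm_eq_abs, ← Finset.mul_sum]
          exact mul_le_mul_of_nonneg_left (abs_conv_blockMeasure_sub_le μ ν V d hd α z)
            (by positivity)
      _ = ∑ α ∈ Finset.univ.erase α₀, ∑ J : Finset ι with J.Nonempty ∧ J ⊂ Finset.univ,
            if J ∈ α.parts then ((α.parts.card - 1).factorial : ℝ) * d J else 0 := by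
          refine Finset.sum_congr rfl fun α hα => ?_
          rw [← Finset.sum_filter]
          refine Finset.sum_congr ?_ fun _ _ => rfl
          ext J
          simp only [Finset.mem_filter, Finset.mem_univ, true_and, Finset.ssubset_univ_iff]
          refine ⟨fun hJ => ⟨⟨α.nonempty_of_mem_parts hJ, fun hu => ?_⟩, hJ⟩, fun h => h.2⟩
          exact Finset.ne_of_mem_erase hα (eq_indiscrete_of_univ_mem hne (hu ▸ hJ))
      _ ≤ ∑ J : Finset ι with J.Nonempty ∧ J ⊂ Finset.univ,
            (fubini (Fintype.card ι - J.card) : ℝ) * d J := by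
          rw [Finset.sum_comm]
          refine Finset.sum_le_sum fun J hJ => ?_
          rw [← Finset.sum_filter, ← Finset.sum_mul]
          refine mul_le_mul_of_nonneg_right ?_ (hd0 J)
          have hJ' : J ≠ Finset.univ := by
            have := (Finset.mem_filter.1 hJ).2.2
            rwa [Finset.ssubset_univ_iff] at this
          have := sum_factorial_parts_le J hJ'
          refine le_trans ?_ (Nat.cast_le.2 this)
          push_cast
          refine Finset.sum_le_sum_of_subset_of_nonneg ?_ fun _ _ _ => by positivity
          intro α hα
          simp only [Finset.mem_filter, Finset.mem_univ, true_and] at hα ⊢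
          exact hα.2
  have h2 := norm_sub_le ((D : ℂ) + ∑ α ∈ Finset.univ.erase α₀, partitionCoeff α * (W α : ℂ))
    (∑ α ∈ Finset.univ.erase α₀, partitionCoeff α * (W α : ℂ))
  rw [add_sub_cancel_right, Complex.norm_real, Real.norm_eq_abs] at h2
  exact h2.trans (by gcongr)

end Blocks


/-! ### Finiteness of the integral under first moments. -/

section Finiteness

open Set Filter

variable {ι : Type*} [Fintype ι]

theorem charFunPi_zero (ρ : Measure (ι → ℝ)) [IsProbabilityMeasure ρ] : charFunPi ρ 0 = 1 := by
  simp [charFunPi]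

theorem norm_charFunPi_sub_le (ρ : Measure (ι → ℝ)) [IsProbabilityMeasure ρ] (l : ι)
    (hρ : Integrable (fun x : ι → ℝ => x l) ρ) (t t' : ι → ℝ) (ht : ∀ k, k ≠ l → t k = t' k) :
    ‖charFunPi ρ t - charFunPi ρ t'‖ ≤ |t l - t' l| * ∫ x, |x l| ∂ρ := by
  have hi : ∀ t : ι → ℝ, Integrable
      (fun x : ι → ℝ => Complex.exp (((∑ l, t l * x l : ℝ) : ℂ) * Complex.I)) ρ := fun t =>
    (integrable_const (1 : ℝ)).mono' (Continuous.aestronglyMeasurable (by fun_prop))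
      (Eventually.of_forall fun x => (Complex.norm_exp_ofReal_mul_I _).le)
  rw [charFunPi, charFunPi, ← integral_sub (hi t) (hi t'), ← integral_const_mul]
  refine norm_integral_le_of_norm_le (hρ.abs.const_mul _) (Eventually.of_forall fun x => ?_)
  have h1 : ∑ k, t k * x k = ∑ k, t' k * x k + (t l - t' l) * x l := by
    rw [← sub_eq_iff_eq_add', ← Finset.sum_sub_distrib, Finset.sum_eq_single l]
    · ring
    · intro k _ hk; rw [ht k hk, sub_self]
    · simp
  have h2 : Complex.exp (((∑ k, t k * x k : ℝ) : ℂ) * Complex.I)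
      = Complex.exp (((∑ k, t' k * x k : ℝ) : ℂ) * Complex.I) *
        Complex.exp ((((t l - t' l) * x l : ℝ) : ℂ) * Complex.I) := by
    rw [← Complex.exp_add, h1]; congr 1; push_cast; ring
  rw [h2, ← mul_sub_one, norm_mul, Complex.norm_exp_ofReal_mul_I, one_mul, ← abs_mul, mul_comm _ Complex.I]
  exact Real.norm_exp_I_mul_ofReal_sub_one_le.trans_eq (Real.norm_eq_abs _)

theorem norm_Lambda_charFunPi_sub_le [DecidableEq ι] (ρ : Measure (ι → ℝ)) [IsProbabilityMeasure ρ] (l : ι)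
    (hρ : Integrable (fun x : ι → ℝ => x l) ρ) :
    ∃ C : ℝ, 0 ≤ C ∧ ∀ t : ι → ℝ,
      ‖Lambda (charFunPi ρ) t - Lambda (charFunPi ρ) (Function.update t l 0)‖ ≤ C * |t l| := by
  refine ⟨∑ α : Finpartition (Finset.univ : Finset ι),
    ‖partitionCoeff α‖ * ∑ J ∈ α.parts, ∫ x, |x l| ∂ρ, ?_, fun t => ?_⟩
  · exact Finset.sum_nonneg fun α _ => mul_nonneg (norm_nonneg _)
      (Finset.sum_nonneg fun J _ => integral_nonneg fun x => abs_nonneg _)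
  rw [Lambda, Lambda, ← Finset.sum_sub_distrib, Finset.sum_mul]
  refine norm_sum_le_of_le _ fun α _ => ?_
  rw [← mul_sub, norm_mul, mul_assoc, Finset.sum_mul]
  refine mul_le_mul_of_nonneg_left ?_ (norm_nonneg _)
  refine (norm_prod_sub_prod_le _ _ _ (fun J _ => norm_charFunPi_le ρ _)
    (fun J _ => norm_charFunPi_le ρ _)).trans (Finset.sum_le_sum fun J _ => ?_)
  refine (norm_charFunPi_sub_le ρ l hρ _ _ fun k hk => ?_).trans ?_
  · simp [zeroOutside, Function.update_of_ne hk]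
  · rw [mul_comm]
    refine mul_le_mul_of_nonneg_left ?_ (integral_nonneg fun x => abs_nonneg _)
    by_cases hl : l ∈ J <;> simp [zeroOutside, hl]

/-- With two or more coordinates both sides vanish. With one coordinate `t = 0` and `Λ(φ)` depends
only on `φ(0) = 1`, so the two values agree without being zero. -/
theorem Lambda_charFunPi_eq [DecidableEq ι] (μ ν : Measure (ι → ℝ)) [IsProbabilityMeasure μ]
    [IsProbabilityMeasure ν] (t : ι → ℝ) {l : ι} (hl : t l = 0) :
    Lambda (charFunPi μ) t = Lambda (charFunPi ν) t := by
  by_cases h2 : 2 ≤ Fintype.card ι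
  · rw [Lambda_eq_zero _ (charFunPi_zero μ) h2 t hl, Lambda_eq_zero _ (charFunPi_zero ν) h2 t hl]
  · have : Subsingleton ι := Fintype.card_le_one_iff_subsingleton.1 (by omega)
    have ht : ∀ J, zeroOutside J t = 0 := by
      intro J; ext k
      rw [Subsingleton.elim k l]
      simp [zeroOutside, hl]
    simp only [Lambda, ht, charFunPi_zero]

/-- Setting `t l` to zero makes the difference vanish, and first moments bound the cost of doing so
linearly in `|t l|`. -/
theorem exists_norm_Lambda_sub_le [DecidableEq ι] [Nonempty ι] (μ ν : Measure (ι → ℝ)) [IsProbabilityMeasure μ]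
    [IsProbabilityMeasure ν] (hμ : ∀ l, Integrable (fun x : ι → ℝ => x l) μ)
    (hν : ∀ l, Integrable (fun x : ι → ℝ => x l) ν) :
    ∃ C : ℝ, 0 ≤ C ∧ ∀ (t : ι → ℝ) (l : ι),
      ‖Lambda (charFunPi μ) t - Lambda (charFunPi ν) t‖ ≤ C * |t l| := by
  choose Cμ hCμ0 hCμ using fun l => norm_Lambda_charFunPi_sub_le μ l (hμ l)
  choose Cν hCν0 hCν using fun l => norm_Lambda_charFunPi_sub_le ν l (hν l)
  refine ⟨∑ l, (Cμ l + Cν l), Finset.sum_nonneg fun l _ => add_nonneg (hCμ0 l) (hCν0 l),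
    fun t l => ?_⟩
  have h0 := Lambda_charFunPi_eq μ ν (Function.update t l 0) (l := l) (by simp)
  have h1 := hCμ l t
  have h2 := hCν l t
  rw [h0] at h1
  have h3 := norm_sub_le_norm_sub_add_norm_sub (Lambda (charFunPi μ) t)
    (Lambda (charFunPi ν) (Function.update t l 0)) (Lambda (charFunPi ν) t)
  rw [norm_sub_rev (Lambda (charFunPi ν) (Function.update t l 0))] at h3
  have h4 : Cμ l + Cν l ≤ ∑ l, (Cμ l + Cν l) :=
    Finset.single_le_sum (f := fun l => Cμ l + Cν l)
      (fun l _ => add_nonneg (hCμ0 l) (hCν0 l)) (Finset.mem_univ l)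
  have h5 := mul_le_mul_of_nonneg_right h4 (abs_nonneg (t l))
  linarith

theorem integrable_indicator_abs_rpow {r : ℝ} (hr : -1 < r) (T : ℝ) :
    Integrable ((Icc (-T) T).indicator fun s : ℝ => |s| ^ r) := by
  rw [integrable_indicator_iff measurableSet_Icc]
  rcases lt_or_ge T 0 with hT | hT
  · rw [Icc_eq_empty (by linarith)]; exact integrableOn_empty
  rw [integrableOn_Icc_iff_integrableOn_Ioc, ← intervalIntegrable_iff_integrableOn_Ioc_of_le
    (by linarith)]
  refine intervalIntegrable_of_even (fun x => by simp) (fun x hx => ?_) (by simp) (by simp)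
  refine (intervalIntegral.intervalIntegrable_rpow' hr (a := 0) (b := x)).congr ?_
  intro y hy
  rw [uIoc_of_le hx.le] at hy
  simp only [abs_of_pos hy.1]

/-- A function that vanishes linearly at each coordinate hyperplane is integrable against
`1 / ∏ t l` on cubes. -/
theorem integrableOn_div_prod_of_le [Nonempty ι] {f : (ι → ℝ) → ℂ} (hf : Continuous f) {C : ℝ}
    (hC0 : 0 ≤ C) (hC : ∀ t l, ‖f t‖ ≤ C * |t l|) (T : ℝ) :
    IntegrableOn (fun t : ι → ℝ => f t / ((∏ l, t l : ℝ) : ℂ)) {t | ‖t‖ ≤ T} := by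
  set m := Fintype.card ι with hm
  have hm0 : m ≠ 0 := Fintype.card_ne_zero
  have hm1 : (0 : ℝ) < m := by positivity
  have hB : MeasurableSet {t : ι → ℝ | ‖t‖ ≤ T} := measurableSet_le measurable_norm measurable_const
  have hdom : Integrable fun t : ι → ℝ =>
      C * ∏ l, (Icc (-T) T).indicator (fun s : ℝ => |s| ^ ((1 : ℝ) / m - 1)) (t l) :=
    (Integrable.fintype_prod fun _ => integrable_indicator_abs_rpow (by
      have : (0 : ℝ) < 1 / m := by positivity
      linarith) T).const_mul C
  refine Integrable.mono' hdom.integrableOn ?_ ?_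
  · refine (Measurable.aestronglyMeasurable ?_)
    exact hf.measurable.div (Continuous.measurable (by fun_prop))
  · filter_upwards [ae_restrict_mem hB, ae_restrict_of_ae (ae_forall_ne_zero (ι := ι))] with t ht ht0
    have hmem : ∀ l, t l ∈ Icc (-T) T := fun l => by
      have := (norm_le_pi_norm t l).trans ht
      rw [Real.norm_eq_abs] at this
      exact abs_le.1 this
    have hpos : ∀ l, 0 < |t l| := fun l => abs_pos.2 (ht0 l)
    simp only [indicator_of_mem (hmem _)]
    have h1 : ‖f t‖ ≤ C * ∏ l, |t l| ^ ((1 : ℝ) / m) := by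
      -- Multiply the `m` bounds, one per coordinate: this is the geometric mean, which leaves an
      -- integrable exponent `1/m - 1 > -1` in each variable.
      have hp : ‖f t‖ ^ m ≤ (C * ∏ l, |t l| ^ ((1 : ℝ) / m)) ^ m := by
        calc ‖f t‖ ^ m = ∏ _l : ι, ‖f t‖ := by rw [Finset.prod_const, Finset.card_univ]
          _ ≤ ∏ l, C * |t l| := Finset.prod_le_prod (fun _ _ => norm_nonneg _) fun l _ => hC t l
          _ = _ := by
            rw [Finset.prod_mul_distrib, Finset.prod_const, Finset.card_univ, mul_pow,
              ← Finset.prod_pow]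
            congr 1
            refine Finset.prod_congr rfl fun l _ => ?_
            rw [one_div, Real.rpow_inv_natCast_pow (abs_nonneg _) hm0]
      exact le_of_pow_le_pow_left₀ hm0 (by positivity) hp
    rw [norm_div, Complex.norm_real, Real.norm_eq_abs, Finset.abs_prod,
      div_le_iff₀ (Finset.prod_pos fun l _ => hpos l), mul_assoc, ← Finset.prod_mul_distrib]
    refine h1.trans_eq ?_
    congr 1
    refine Finset.prod_congr rfl fun l _ => ?_
    rw [Real.rpow_sub_one (hpos l).ne', div_mul_cancel₀ _ (hpos l).ne']

theorem continuous_Lambda_charFunPi [DecidableEq ι] (ρ : Measure (ι → ℝ)) [IsProbabilityMeasure ρ] :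
    Continuous (Lambda (charFunPi ρ)) := by
  have : Lambda (charFunPi ρ) =
      fun t => ∑ α, partitionCoeff α * charFunPi (blockMeasure ρ α) t :=
    funext (Lambda_charFunPi ρ)
  rw [this]
  exact continuous_finsetSum _ fun α _ => continuous_const.mul (continuous_charFunPi _)

end Finiteness


/-! ### From random vectors to their laws; Lipschitz bound from partial derivatives. -/

section Transfer

open Set Filter

variable {Ω Ω' ι : Type*} [MeasurableSpace Ω] [MeasurableSpace Ω'] {P : Measure Ω}
  {P' : Measure Ω'} {X : Ω → ι → ℝ} {Y : Ω' → ι → ℝ}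

theorem cdfVec_eq [Fintype ι] (hX : AEMeasurable X P) (z : ι → ℝ) :
    cdfVec P X z = (P.map X).real (Iic z) := by
  rw [measureReal_def, Measure.map_apply_of_aemeasurable hX measurableSet_Iic]
  rfl

theorem cdfVec_marginal_eq [Fintype ι] (hX : AEMeasurable X P) (J : Finset ι) (z : ι → ℝ) :
    cdfVec P (marginal J X) (fun j => z j) = marginalCdf (P.map X) J z := by
  rw [marginalCdf, measureReal_def, Measure.map_apply_of_aemeasurable hX]
  · rw [cdfVec, measureReal_def]
    congr 2
    ext ω
    simp [marginal, Pi.le_def]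
  · have : {x : ι → ℝ | ∀ l ∈ J, x l ≤ z l} = ⋂ l ∈ J, {x | x l ≤ z l} := by ext; simp
    rw [this]
    exact J.measurableSet_biInter fun l _ =>
      measurableSet_le (measurable_pi_apply l) measurable_const

theorem charFunVec_eq [Fintype ι] (hX : AEMeasurable X P) : charFunVec P X = charFunPi (P.map X) := by
  ext t
  have hm : AEMeasurable (fun ω => (WithLp.toLp 2 (X ω) : EuclideanSpace ℝ ι)) P :=
    (WithLp.measurable_toLp 2 _).comp_aemeasurable hX
  rw [charFunVec, charFun_apply, integral_map hm
    (Continuous.aestronglyMeasurable (by fun_prop)), charFunPi, integral_map hX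
    (Continuous.aestronglyMeasurable (by fun_prop))]
  simp [PiLp.inner_apply]

theorem abs_cdfVec_sub_le_one [IsProbabilityMeasure P] [IsProbabilityMeasure P'] (z : ι → ℝ) :
    |cdfVec P X z - cdfVec P' Y z| ≤ 1 := by
  have h1 : cdfVec P X z ≤ 1 := measureReal_le_one
  have h2 : cdfVec P' Y z ≤ 1 := measureReal_le_one
  have h3 : 0 ≤ cdfVec P X z := measureReal_nonneg
  have h4 : 0 ≤ cdfVec P' Y z := measureReal_nonneg
  rw [abs_le]
  constructor <;> linarith

theorem cdfDist_ne_top [IsProbabilityMeasure P] [IsProbabilityMeasure P'] :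
    cdfDist P P' X Y ≠ ⊤ :=
  ne_top_of_le_ne_top ENNReal.one_ne_top (iSup_le fun z => by
    rw [← ENNReal.ofReal_one]; exact ENNReal.ofReal_le_ofReal (abs_cdfVec_sub_le_one z))

theorem abs_cdfVec_sub_le [IsProbabilityMeasure P] [IsProbabilityMeasure P'] (z : ι → ℝ) :
    |cdfVec P X z - cdfVec P' Y z| ≤ (cdfDist P P' X Y).toReal := by
  rw [← ENNReal.ofReal_le_iff_le_toReal cdfDist_ne_top]
  exact le_iSup (fun z => ENNReal.ofReal |cdfVec P X z - cdfVec P' Y z|) z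

/-- Mean value inequality for a differentiable function with bounded partial derivatives. -/
theorem sub_le_sum_mul_of_fderiv_le [Fintype ι] [DecidableEq ι] {F : (ι → ℝ) → ℝ}
    (hF : Differentiable ℝ F) (a : ι → ℝ) (ha : ∀ y l, fderiv ℝ F y (Pi.single l 1) ≤ a l)
    {z z' : ι → ℝ} (hz : z ≤ z') : F z' - F z ≤ ∑ l, a l * (z' l - z l) := by
  set u : ι → ℝ := z' - z
  have hu : ∀ l, 0 ≤ u l := fun l => sub_nonneg.2 (hz l)
  have hd : ∀ s : ℝ, HasDerivAt (fun s : ℝ => F (z + s • u)) (fderiv ℝ F (z + s • u) u) s := by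
    intro s
    have h1 : HasDerivAt (fun s : ℝ => z + s • u) u s := by
      simpa using ((hasDerivAt_id s).smul_const u).const_add z
    exact (hF _).hasFDerivAt.comp_hasDerivAt s h1
  have hle : ∀ y, fderiv ℝ F y u ≤ ∑ l, a l * u l := by
    intro y
    have h1 : u = ∑ l, u l • (Pi.single l 1 : ι → ℝ) := by
      ext k; simp [Finset.sum_apply, Pi.single_apply]
    conv_lhs => rw [h1]
    rw [map_sum]
    refine Finset.sum_le_sum fun l _ => ?_
    rw [map_smul, smul_eq_mul, mul_comm]
    exact mul_le_mul_of_nonneg_right (ha y l) (hu l)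
  have h2 := (convex_Icc (0 : ℝ) 1).image_sub_le_mul_sub_of_deriv_le
    (f := fun s : ℝ => F (z + s • u)) (C := ∑ l, a l * u l)
    (fun s _ => (hd s).continuousAt.continuousWithinAt)
    (fun s _ => (hd s).differentiableAt.differentiableWithinAt)
    (fun s _ => by rw [(hd s).deriv]; exact hle _) 0 (by simp) 1 (by simp) zero_le_one
  simpa [u] using h2

end Transfer

/-! ### The numerical constants. -/

section Constants

theorem C₁_nonneg (m : ℕ) (hm : 1 ≤ m) : 0 ≤ C₁ m ∧
    C₁ m ^ 3 = 32 / (Real.pi * (1 - (3 / 4 : ℝ) ^ (1 / (m : ℝ)))) := by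
  have h1 : (3 / 4 : ℝ) ^ (1 / (m : ℝ)) < 1 :=
    Real.rpow_lt_one (by norm_num) (by norm_num) (by positivity)
  have h2 : 0 ≤ 32 / (Real.pi * (1 - (3 / 4 : ℝ) ^ (1 / (m : ℝ)))) :=
    div_nonneg (by norm_num) (mul_nonneg Real.pi_pos.le (by linarith))
  refine ⟨Real.rpow_nonneg h2 _, ?_⟩
  rw [C₁, ← Real.rpow_natCast, ← Real.rpow_mul h2]
  norm_num

theorem C₂_pos : 0 < C₂ := by unfold C₂; positivity

/-- A cube has mass `q ^ m`, so each coordinate may lose at most `1 - (3/4)^(1/m)`. Already `C₁`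
ensures this, since `(4/3)^3 * 32 ≥ 64`; `C₂` only adds room. -/
theorem three_quarters_le_pow (m : ℕ) (hm : 1 ≤ m) {q : ℝ}
    (hq : 1 - 64 / (Real.pi * (4 / 3 * (C₁ m + C₂)) ^ 3) ≤ q) : 3 / 4 ≤ q ^ m := by
  obtain ⟨h0, h3⟩ := C₁_nonneg m hm
  have hπ := Real.pi_pos
  set e := (3 / 4 : ℝ) ^ (1 / (m : ℝ)) with he
  have he0 : 0 ≤ e := Real.rpow_nonneg (by norm_num) _
  have he1 : e < 1 := Real.rpow_lt_one (by norm_num) (by norm_num) (by positivity)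
  have hpow : e ^ m = 3 / 4 := by
    rw [he, one_div, Real.rpow_inv_natCast_pow (by norm_num) (by omega)]
  rw [← hpow]
  refine pow_le_pow_left₀ he0 (le_trans ?_ hq) m
  have hκ : 0 < 1 - e := by linarith
  have h4 : 64 / (Real.pi * (1 - e)) ≤ (4 / 3 * (C₁ m + C₂)) ^ 3 := by
    calc 64 / (Real.pi * (1 - e)) ≤ 64 / 27 * (32 / (Real.pi * (1 - e))) := by
          rw [← mul_div_assoc]; gcongr; norm_num
      _ = (4 / 3 * C₁ m) ^ 3 := by rw [mul_pow, h3]; norm_num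
      _ ≤ _ := by gcongr; linarith [C₂_pos]
  rw [div_le_iff₀ (by positivity)] at h4
  have h5 : 64 / (Real.pi * (4 / 3 * (C₁ m + C₂)) ^ 3) ≤ 1 - e := by
    rw [div_le_iff₀ (by have := C₂_pos; positivity)]
    linarith
  linarith

end Constants

/-! ### Assembly of the inequality. -/

section Main

open Set Filter

/-- The smoothing inequality with the operator `Λ`, for probability measures on `ℝ^m`. -/
theorem abs_measureReal_Iic_sub_le (m : ℕ) (hm : 1 ≤ m) (μ ν : Measure (Fin m → ℝ))
    [IsProbabilityMeasure μ] [IsProbabilityMeasure ν] {T : ℝ} (hT : 0 < T) (a : Fin m → ℝ)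
    (ha : ∀ l, 0 ≤ a l)
    (hν : ∀ z z' : Fin m → ℝ, z ≤ z' →
      ν.real (Iic z') - ν.real (Iic z) ≤ ∑ l, a l * (z' l - z l))
    (d : Finset (Fin m) → ℝ) (hd0 : ∀ J, 0 ≤ d J)
    (hd : ∀ J z, |marginalCdf μ J z - marginalCdf ν J z| ≤ d J)
    (hint : IntegrableOn (fun t : Fin m → ℝ =>
      (Lambda (charFunPi μ) t - Lambda (charFunPi ν) t) / ((∏ l, t l : ℝ) : ℂ)) {t | ‖t‖ ≤ T})
    (z : Fin m → ℝ) :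
    |μ.real (Iic z) - ν.real (Iic z)| ≤
      2 / (2 * Real.pi) ^ m * (∫ t : Fin m → ℝ in {t | ‖t‖ ≤ T},
        ‖(Lambda (charFunPi μ) t - Lambda (charFunPi ν) t) / ((∏ l, t l : ℝ) : ℂ)‖)
      + 2 * ∑ J : Finset (Fin m) with J.Nonempty ∧ J ⊂ Finset.univ,
          (fubini (m - J.card) : ℝ) * d J
      + 2 * (∑ l, a l) / T * (C₁ m + C₂) := by
  obtain ⟨v, g, h⟩ := exists_smoothing_density T hT
  have := h.isProbabilityMeasure_pi (ι := Fin m)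
  have hC : 0 < C₁ m + C₂ := add_pos_of_nonneg_of_pos (C₁_nonneg m hm).1 C₂_pos
  -- Chosen so that the smoothing cost `3/2 * r * ∑ a l` equals `2 * (∑ a l) / T * (C₁ + C₂)`.
  set r : ℝ := 4 / 3 * (C₁ m + C₂) / T with hr
  have hr0 : 0 < r := by positivity
  have hp : 3 / 4 ≤ (densityPi (Fin m) v).real (cube (Fin m) r) := by
    rw [h.measureReal_cube, Fintype.card_fin]
    refine three_quarters_le_pow m hm ?_
    have h1 := h.one_sub_le hr0
    rwa [hr, mul_div_cancel₀ _ hT.ne'] at h1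
  have hS := fun z => abs_conv_sub_le (Fin.pos_iff_nonempty.1 hm) μ ν (densityPi (Fin m) v) d hd0 hd z
  have hinv : ∀ z, ‖∑ α : Finpartition (Finset.univ : Finset (Fin m)), partitionCoeff α *
        (((blockMeasure μ α ∗ densityPi (Fin m) v).real (Iic z)
          - (blockMeasure ν α ∗ densityPi (Fin m) v).real (Iic z) : ℝ) : ℂ)‖
      ≤ 1 / (2 * Real.pi) ^ m * ∫ t : Fin m → ℝ in {t | ‖t‖ ≤ T},
        ‖(Lambda (charFunPi μ) t - Lambda (charFunPi ν) t) / ((∏ l, t l : ℝ) : ℂ)‖ := by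
    intro z
    -- The block laws of `μ` and, with opposite sign, those of `ν` form a single combination. Only
    -- for this difference is the quotient by `∏ t l` assumed integrable.
    let ρ : Finpartition (Finset.univ : Finset (Fin m)) ⊕
        Finpartition (Finset.univ : Finset (Fin m)) → Measure (Fin m → ℝ) :=
      Sum.elim (blockMeasure μ) (blockMeasure ν)
    let c : Finpartition (Finset.univ : Finset (Fin m)) ⊕
        Finpartition (Finset.univ : Finset (Fin m)) → ℂ :=
      Sum.elim partitionCoeff (fun α => -partitionCoeff α)
    have : ∀ b, IsProbabilityMeasure (ρ b) := by
      rintro (b | b) <;> simp only [ρ, Sum.elim_inl, Sum.elim_inr] <;> infer_instance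
    have h1 := h.norm_sum_conv_le Finset.univ c ρ _ (fun t => ?_) hint z
    · rw [Fintype.card_fin] at h1
      refine le_trans (le_of_eq ?_) h1
      congr 1
      rw [Fintype.sum_sum_type, ← Finset.sum_add_distrib]
      refine Finset.sum_congr rfl fun α _ => ?_
      simp only [ρ, c, Sum.elim_inl, Sum.elim_inr]
      push_cast
      ring
    · rw [Lambda_charFunPi, Lambda_charFunPi, Fintype.sum_sum_type, sub_eq_add_neg,
        ← Finset.sum_neg_distrib]
      simp only [ρ, c, Sum.elim_inl, Sum.elim_inr, neg_mul]
  have hS' := fun z => (hS z).trans (add_le_add_left (hinv z) _)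
  refine (h.abs_sub_le μ ν a ha hν hr0.le hp hS' z).trans_eq ?_
  rw [Fintype.card_fin, hr]
  ring

end Main

end BerryEsseen

end

theorem theorem2 {Ω Ω' : Type*} [MeasurableSpace Ω] [MeasurableSpace Ω']
    (P : Measure Ω) [IsProbabilityMeasure P] (P' : Measure Ω') [IsProbabilityMeasure P']
    (m : ℕ) (hm : 1 ≤ m) (X : Ω → Fin m → ℝ) (Y : Ω' → Fin m → ℝ)
    (hX : AEMeasurable X P) (hY : AEMeasurable Y P')
    (hF : Differentiable ℝ (BerryEsseen.cdfVec P' Y)) (T : ℝ) (hT : 0 < T) :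
    BerryEsseen.cdfDist P P' X Y ≤
        ENNReal.ofReal (2 / (2 * Real.pi) ^ m) * BerryEsseen.lambdaIntegral P P' X Y T
        + 2 * ∑ J : Finset (Fin m) with J.Nonempty ∧ J ⊂ Finset.univ,
            (BerryEsseen.fubini (m - J.card) : ℝ≥0∞) *
              BerryEsseen.cdfDist P P' (BerryEsseen.marginal J X) (BerryEsseen.marginal J Y)
        + 2 * (∑ j, BerryEsseen.supPartialDeriv P' Y j) / ENNReal.ofReal T
            * ENNReal.ofReal (BerryEsseen.C₁ m + BerryEsseen.C₂)
      ∧ (Integrable X P → Integrable Y P' → BerryEsseen.lambdaIntegral P P' X Y T < ∞) := by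
  open BerryEsseen in
  have hπ := Real.pi_pos
  have : IsProbabilityMeasure (P.map X) := Measure.isProbabilityMeasure_map hX
  have : IsProbabilityMeasure (P'.map Y) := Measure.isProbabilityMeasure_map hY
  have hC : 0 < C₁ m + C₂ := add_pos_of_nonneg_of_pos (C₁_nonneg m hm).1 C₂_pos
  have hcont : Continuous fun t =>
      Lambda (charFunPi (P.map X)) t - Lambda (charFunPi (P'.map Y)) t :=
    (continuous_Lambda_charFunPi _).sub (continuous_Lambda_charFunPi _)
  have hl : lambdaIntegral P P' X Y T = ∫⁻ t : Fin m → ℝ in {t | ‖t‖ ≤ T},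
      ‖(Lambda (charFunPi (P.map X)) t - Lambda (charFunPi (P'.map Y)) t) /
        ((∏ l, t l : ℝ) : ℂ)‖ₑ := by
    rw [lambdaIntegral, charFunVec_eq hX, charFunVec_eq hY]
  constructor
  -- If the integral or the sum of the suprema is infinite, its prefactor is nonzero and the right
  -- side is `⊤`. Otherwise all quantities are real and the real inequality applies.
  · by_cases hI : lambdaIntegral P P' X Y T = ⊤
    · have : ENNReal.ofReal (2 / (2 * Real.pi) ^ m) ≠ 0 := by
        rw [Ne, ENNReal.ofReal_eq_zero, not_le]; positivity
      rw [hI, ENNReal.mul_top this, top_add, top_add]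
      exact le_top
    by_cases hA : ∑ j, supPartialDeriv P' Y j = ⊤
    · have : ENNReal.ofReal (C₁ m + C₂) ≠ 0 := by
        rwa [Ne, ENNReal.ofReal_eq_zero, not_le]
      rw [hA, ENNReal.mul_top two_ne_zero, ENNReal.top_div_of_ne_top ENNReal.ofReal_ne_top,
        ENNReal.top_mul this, add_top]
      exact le_top
    have hA' : ∀ j, supPartialDeriv P' Y j ≠ ⊤ := fun j h =>
      hA (ENNReal.sum_eq_top.2 ⟨j, Finset.mem_univ j, h⟩)
    have hint : IntegrableOn (fun t : Fin m → ℝ =>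
        (Lambda (charFunPi (P.map X)) t - Lambda (charFunPi (P'.map Y)) t) /
          ((∏ l, t l : ℝ) : ℂ)) {t | ‖t‖ ≤ T} := by
      refine ⟨(hcont.measurable.div
        (Continuous.measurable (by fun_prop))).aestronglyMeasurable, ?_⟩
      rw [HasFiniteIntegral, ← hl]
      exact lt_top_iff_ne_top.2 hI
    refine iSup_le fun z => ?_
    have key := abs_measureReal_Iic_sub_le m hm (P.map X) (P'.map Y) hT
      (fun j => (supPartialDeriv P' Y j).toReal) (fun _ => ENNReal.toReal_nonneg)
      (fun z z' hz => by
        rw [← cdfVec_eq hY, ← cdfVec_eq hY]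
        refine sub_le_sum_mul_of_fderiv_le hF _ (fun y l => ?_) hz
        refine (ENNReal.ofReal_le_iff_le_toReal (hA' l)).1 ?_
        exact le_iSup (fun y => ENNReal.ofReal (fderiv ℝ (cdfVec P' Y) y (Pi.single l 1))) y)
      (fun J => (cdfDist P P' (marginal J X) (marginal J Y)).toReal)
      (fun _ => ENNReal.toReal_nonneg)
      (fun J z => by
        rw [← cdfVec_marginal_eq hX, ← cdfVec_marginal_eq hY]
        exact abs_cdfVec_sub_le _) hint z
    rw [← cdfVec_eq hX, ← cdfVec_eq hY] at key
    refine (ENNReal.ofReal_le_ofReal key).trans_eq ?_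
    have hI0 : 0 ≤ ∫ t : Fin m → ℝ in {t | ‖t‖ ≤ T},
        ‖(Lambda (charFunPi (P.map X)) t - Lambda (charFunPi (P'.map Y)) t) /
          ((∏ l, t l : ℝ) : ℂ)‖ := integral_nonneg fun _ => norm_nonneg _
    have hB0 : 0 ≤ ∑ J : Finset (Fin m) with J.Nonempty ∧ J ⊂ Finset.univ,
        (fubini (m - J.card) : ℝ) * (cdfDist P P' (marginal J X) (marginal J Y)).toReal :=
      Finset.sum_nonneg fun _ _ => by positivity
    have hA0 : 0 ≤ ∑ j, (supPartialDeriv P' Y j).toReal :=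
      Finset.sum_nonneg fun _ _ => ENNReal.toReal_nonneg
    have e1 : ∀ j, ENNReal.ofReal (supPartialDeriv P' Y j).toReal = supPartialDeriv P' Y j :=
      fun j => ENNReal.ofReal_toReal (hA' j)
    have e2 : ∀ J : Finset (Fin m), ENNReal.ofReal ((fubini (m - J.card) : ℝ) *
        (cdfDist P P' (marginal J X) (marginal J Y)).toReal) =
        fubini (m - J.card) * cdfDist P P' (marginal J X) (marginal J Y) := fun J => by
      rw [ENNReal.ofReal_mul (by positivity), ENNReal.ofReal_natCast,
        ENNReal.ofReal_toReal cdfDist_ne_top]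
    rw [ENNReal.ofReal_add (by positivity) (by positivity),
      ENNReal.ofReal_add (by positivity) (by positivity), ENNReal.ofReal_mul (by positivity),
      ENNReal.ofReal_mul (by positivity), ENNReal.ofReal_mul (by positivity),
      ENNReal.ofReal_div_of_pos hT, ENNReal.ofReal_mul (by positivity), ENNReal.ofReal_ofNat,
      ofReal_integral_norm_eq_lintegral_enorm hint, ← hl,
      ENNReal.ofReal_sum_of_nonneg (fun _ _ => by positivity),
      ENNReal.ofReal_sum_of_nonneg (fun _ _ => ENNReal.toReal_nonneg)]
    simp only [e1, e2]
  · intro hXi hYi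
    have : Nonempty (Fin m) := Fin.pos_iff_nonempty.1 hm
    have hX1 : ∀ l, Integrable (fun x : Fin m → ℝ => x l) (P.map X) := fun l =>
      (integrable_map_measure (measurable_pi_apply l).aestronglyMeasurable hX).2 (hXi.eval l)
    have hY1 : ∀ l, Integrable (fun x : Fin m → ℝ => x l) (P'.map Y) := fun l =>
      (integrable_map_measure (measurable_pi_apply l).aestronglyMeasurable hY).2 (hYi.eval l)
    obtain ⟨C, hC0, hC⟩ := exists_norm_Lambda_sub_le (P.map X) (P'.map Y) hX1 hY1
    rw [hl]
    exact (integrableOn_div_prod_of_le hcont hC0 hC T).2
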